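/- **Theorem (Local Variety Theorem for Reduced Languages).** *Setting.* Let $\mathscr D$ be a locally finite variety of (one-sorted, finitary) algebras or ordered algebras in which all epimorphisms are surjective, and let $\mathscr C$ be a locally finite variety of algebras whose signature contains a constant (one constant is fixed). Assume given a dual equivalence $P\colon \mathscr D_f^{op}\simeq \mathscr C_f$ between the full subcategories of finite algebras. Let $S$ be a finite set of sorts, $\mathbf T=(T,\eta,\mu)$ a monad on $\mathscr D^S$ such that $T$ preserves epimorphisms, and $\mathcal F$ a class of finite $\mathbf T$-algebras closed under quotients, subalgebras and finite products. Quotients are the sortwise surjective morphisms, subobjects the sortwise injective (in the ordered case: order-reflecting) ones. Fix $S_0\subseteq S$ and a finite $S$-sorted alphabet $\Sigma$, let $\mathbb\Sigma\in\mathscr D^S$ be the free object on $\Sigma$, and $\mathbf T\mathbb\Sigma$ the free $\mathbf T$-algebra on it. Let $\mathbb U_\Sigma$ be a unary presentation of $\mathbf T\mathbb\Sigma$, i.e. a set of morphisms $u\colon (T\mathbb\Sigma)_s\to (T\mathbb\Sigma)_t$ ($s,t\in S$) in $\mathscr D$ such that every quotient $e\colon T\mathbb\Sigma\twoheadrightarrow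 B$ in $\mathscr D^S$ that factorizes through a quotient algebra of $\mathbf T\mathbb\Sigma$ in $\mathcal F$ carries a $\mathbf T$-homomorphism if and only if each $u\in\mathbb U_\Sigma$ lifts along $e$ (there is $u_B\colon B_s\to B_t$ with $e_t\cdot u=u_B\cdot e_s$). Let $\overline{\mathbb U}_\Sigma$ be its closure under composition and identities. *Algebras.* A $\mathbf T$-algebra $A$ is *reduced* if every quotient $A\twoheadrightarrow B$ of $\mathbf T$-algebras whose components of sorts $s\in S_0$ are isomorphisms is an isomorphism. A *$\Sigma$-generated reduced $\mathcal F$-algebra* is a quotient $e\colon\mathbf T\mathbb\Sigma\twoheadrightarrow A$ of $\mathbf T$-algebras with $A\in\mathcal F$ reduced; put $e\le e'$ if $e$ factorizes through $e'$, and identify $e,e'$ if $e\le e'\le e$. A *local pseudovariety of $\Sigma$-generated reduced $\mathcal F$-algebras* is an ideal (a nonempty, downwards closed, directed subset) of the resulting poset. Local pseudovarieties are ordered by inclusion. *Languages.* Let $\mathbf 1_{\mathscr C},\mathbf 1_{\mathscr D}$ be the free objects on one generator and $O_{\mathscr D}=P^{-1}\mathbf 1_{\mathscr C}$, $O_{\mathscr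 C}=P\mathbf 1_{\mathscr D}$; there is a canonical bijection $|O_{\mathscr D}|\cong|O_{\mathscr C}|$, which sends $y$ to the image of the generator of $\mathbf 1_{\mathscr C}$ under $\mathbf 1_{\mathscr C}\cong PO_{\mathscr D}\to P\mathbf 1_{\mathscr D}=O_{\mathscr C}$, where the second map is the dual of the morphism $\mathbf 1_{\mathscr D}\to O_{\mathscr D}$ determined by $y$. A *reduced language* over $\Sigma$ is a family $L=(L_s\colon(T\mathbb\Sigma)_s\to O_{\mathscr D})_{s\in S_0}$ of morphisms in $\mathscr D$; it is *$\mathcal F$-recognizable* if there are a quotient $h\colon\mathbf T\mathbb\Sigma\twoheadrightarrow A$ of $\mathbf T$-algebras with $A\in\mathcal F$ and morphisms $p_s\colon A_s\to O_{\mathscr D}$ with $L_s=p_s\cdot h_s$ for all $s\in S_0$. The fixed constant dualizes to constant morphisms $\bot\colon D\to O_{\mathscr D}$. A *local variety of reduced languages* over $\Sigma$ is a set $W$ of $\mathcal F$-recognizable reduced languages such that 1. $W$ is a subalgebra in $\mathscr C$ of $\prod_{s\in S_0}O_{\mathscr C}^{|(T\mathbb\Sigma)_s|}$, where languages are viewed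 as elements of this product via $|O_{\mathscr D}|\cong|O_{\mathscr C}|$; 2. for all $L\in W$ and $u\colon(T\mathbb\Sigma)_s\to(T\mathbb\Sigma)_t$ in $\overline{\mathbb U}_\Sigma$ with $s,t\in S_0$, the derivative $u^{-1}L$, given by $(u^{-1}L)_s=L_t\cdot u$ and $(u^{-1}L)_r=\bot$ for $r\in S_0\setminus\{s\}$, lies in $W$; 3. for every family $(L^s)_{s\in S_0}$ in $W$, the diagonal language $(L^s_s)_{s\in S_0}$ lies in $W$. Local varieties are ordered by inclusion. *Statement.* The local varieties of reduced languages over $\Sigma$ and the local pseudovarieties of $\Sigma$-generated reduced $\mathcal F$-algebras both form lattices, and these two lattices are isomorphic. -/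

import Mathlib

open CategoryTheory CategoryTheory.Limits Opposite

universe w u

/-! ### Varieties of algebras and of ordered algebras -/

/-- Terms over a one-sorted finitary signature with variables in `X`. -/
inductive AlgTerm (Op : Type u) (arity : Op → ℕ) (X : Type u) : Type u
  | var : X → AlgTerm Op arity X
  | app : (o : Op) → (Fin (arity o) → AlgTerm Op arity X) → AlgTerm Op arity X

/-- The value of a term in a set `A` with operations. -/
def AlgTerm.eval {Op : Type u} {arity : Op → ℕ} {X A : Type u}
    (op : (o : Op) → (Fin (arity o) → A) → A) (v : X → A) : AlgTerm Op arity X → A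
  | .var x => v x
  | .app o t => op o fun i => (t i).eval op v

/-- A presentation of a variety: a finitary one-sorted signature, a flag that says whether the
variety is one of ordered algebras (`ordered`) or of plain algebras (`¬ ordered`), and a set of
pairs of terms over countably many variables, read as inequations `l ≤ r` in the ordered case and
as equations `l = r` in the unordered case. -/
structure AlgVariety where
  Op : Type u
  arity : Op → ℕ
  ordered : Prop
  rel : Set (AlgTerm Op arity (ULift.{u} ℕ) × AlgTerm Op arity (ULift.{u} ℕ))

namespace AlgVariety

/-- An algebra of the variety. In the unordered case the order is required to be trivial, so that it
carries no information: monotonicity is automatic, `rel` consists of equations, and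
order-reflecting maps are the injective maps. -/
structure Alg (V : AlgVariety.{u}) where
  carrier : Type u
  [order : PartialOrder carrier]
  op : (o : V.Op) → (Fin (V.arity o) → carrier) → carrier
  op_mono : ∀ o, Monotone (op o)
  trivial_order : ¬ V.ordered → ∀ a b : carrier, a ≤ b → a = b
  sat : ∀ p ∈ V.rel, ∀ v : ULift.{u} ℕ → carrier, p.1.eval op v ≤ p.2.eval op v

attribute [instance] Alg.order

/-- Morphisms of the variety: monotone homomorphisms. -/
@[ext]
structure AlgHom {V : AlgVariety.{u}} (A B : V.Alg) where
  toFun : A.carrier → B.carrier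
  mono : Monotone toFun
  map_op : ∀ o (a : Fin (V.arity o) → A.carrier),
    toFun (A.op o a) = B.op o fun i => toFun (a i)

instance (V : AlgVariety.{u}) : Category.{u} V.Alg where
  Hom A B := AlgHom A B
  id A := ⟨fun a => a, monotone_id, fun _ _ => rfl⟩
  comp f g := ⟨fun a => g.toFun (f.toFun a), g.mono.comp f.mono, fun o a => by
    rw [f.map_op, g.map_op]⟩

/-- The underlying map of a morphism. -/
def fn {V : AlgVariety.{u}} {A B : V.Alg} (f : A ⟶ B) : A.carrier → B.carrier := AlgHom.toFun f

variable (V : AlgVariety.{u})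

/-- An algebra is finitely generated if some finite subset lies in no proper subalgebra. -/
def FinGen {V : AlgVariety.{u}} (A : V.Alg) : Prop :=
  ∃ X : Set A.carrier, X.Finite ∧ ∀ B : Set A.carrier, X ⊆ B →
    (∀ o (a : Fin (V.arity o) → A.carrier), (∀ i, a i ∈ B) → A.op o a ∈ B) → B = Set.univ

/-- A variety is locally finite if its finitely generated algebras are finite. -/
class LocallyFinite : Prop where
  finite_of_finGen : ∀ A : V.Alg, FinGen A → Finite A.carrier

/-- The full subcategory of finite algebras. -/
abbrev FinAlg := ObjectProperty.FullSubcategory fun A : V.Alg => Finite A.carrier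

/-! ### Free algebras -/

/-- Terms over `X` in the signature of the variety. -/
def FreeTerm (X : Type u) : Type u := AlgTerm V.Op V.arity X

/-- The preorder on terms over `X` whose quotient is the free algebra on `X`. -/
instance (X : Type u) : Preorder (FreeTerm V X) where
  le t t' := ∀ (A : V.Alg) (v : X → A.carrier),
    AlgTerm.eval A.op v t ≤ AlgTerm.eval A.op v t'
  le_refl _ _ _ := le_rfl
  le_trans _ _ _ h h' A v := (h A v).trans (h' A v)

/-- The carrier of the free algebra on `X`: terms modulo the (in)equations valid in the variety. -/
abbrev FreeCarrier (X : Type u) : Type u := Antisymmetrization (FreeTerm V X) (· ≤ ·)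

/-- The class of a term in the free algebra. -/
def FreeCarrier.mk {V : AlgVariety.{u}} {X : Type u} (t : AlgTerm V.Op V.arity X) :
    FreeCarrier V X :=
  toAntisymmetrization (α := FreeTerm V X) (· ≤ ·) t

/-- A term representing a given element of the free algebra. -/
noncomputable def FreeCarrier.out {V : AlgVariety.{u}} {X : Type u} (a : FreeCarrier V X) :
    AlgTerm V.Op V.arity X :=
  ofAntisymmetrization (α := FreeTerm V X) (· ≤ ·) a

theorem FreeCarrier.mk_out {V : AlgVariety.{u}} {X : Type u} (a : FreeCarrier V X) :
    FreeCarrier.mk a.out = a :=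
  toAntisymmetrization_ofAntisymmetrization (α := FreeTerm V X) (· ≤ ·) a

theorem FreeCarrier.mk_le_mk {V : AlgVariety.{u}} {X : Type u} {t t' : AlgTerm V.Op V.arity X} :
    FreeCarrier.mk t ≤ FreeCarrier.mk t' ↔
      ∀ (A : V.Alg) (v : X → A.carrier), t.eval A.op v ≤ t'.eval A.op v :=
  Iff.rfl

theorem FreeCarrier.out_eval {V : AlgVariety.{u}} {X : Type u} (t : AlgTerm V.Op V.arity X)
    (A : V.Alg) (v : X → A.carrier) : (FreeCarrier.mk t).out.eval A.op v = t.eval A.op v :=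
  le_antisymm (mk_le_mk.1 (mk_out (mk t)).le A v) (mk_le_mk.1 (mk_out (mk t)).ge A v)

/-- The operations of the free algebra. -/
noncomputable def freeOp (X : Type u) (o : V.Op) (a : Fin (V.arity o) → FreeCarrier V X) :
    FreeCarrier V X :=
  FreeCarrier.mk (.app o fun i => (a i).out)

theorem eval_freeOp {V : AlgVariety.{u}} {X : Type u} (A : V.Alg) (v : X → A.carrier)
    {Y : Type u} (t : AlgTerm V.Op V.arity Y) (c : Y → FreeCarrier V X) :
    (t.eval (freeOp V X) c).out.eval A.op v = t.eval A.op fun y => (c y).out.eval A.op v := by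
  induction t with
  | var y => rfl
  | app o t ih =>
    simp only [AlgTerm.eval, freeOp, FreeCarrier.out_eval]
    congr 1
    funext i
    exact ih i

theorem FreeCarrier.le_iff {V : AlgVariety.{u}} {X : Type u} {a b : FreeCarrier V X} :
    a ≤ b ↔ ∀ (A : V.Alg) (v : X → A.carrier), a.out.eval A.op v ≤ b.out.eval A.op v := by
  rw [← mk_le_mk, mk_out, mk_out]

/-- The free algebra on the set `X`. -/
noncomputable def free (X : Type u) : V.Alg where
  carrier := FreeCarrier V X
  op := freeOp V X
  op_mono o a b h := FreeCarrier.mk_le_mk.2 fun A v => by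
    simp only [AlgTerm.eval]
    exact A.op_mono o fun i => FreeCarrier.le_iff.1 (h i) A v
  trivial_order hV a b h := le_antisymm h <| FreeCarrier.le_iff.2 fun A v =>
    (A.trivial_order hV _ _ (FreeCarrier.le_iff.1 h A v)).ge
  sat p hp c := FreeCarrier.le_iff.2 fun A v => by
    rw [eval_freeOp, eval_freeOp]
    exact A.sat p hp _

/-- The insertion of generators. -/
def freeUnit (X : Type u) (x : X) : (free V X).carrier := FreeCarrier.mk (.var x)

/-- The unique extension of a map on generators to a morphism. -/
noncomputable def freeLift {V : AlgVariety.{u}} {X : Type u} {A : V.Alg} (v : X → A.carrier) :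
    free V X ⟶ A :=
  AlgHom.mk (A := free V X) (fun a => FreeCarrier.out a |>.eval A.op v)
    (fun _ _ h => FreeCarrier.le_iff.1 h A v)
    (fun _ _ => FreeCarrier.out_eval _ A v)

theorem freeLift_unit {V : AlgVariety.{u}} {X : Type u} {A : V.Alg} (v : X → A.carrier) (x : X) :
    fn (freeLift v) (freeUnit V X x) = v x :=
  FreeCarrier.out_eval _ A v

theorem eval_var_freeOp {V : AlgVariety.{u}} {X : Type u} (t : AlgTerm V.Op V.arity X) :
    t.eval (freeOp V X) (freeUnit V X) = FreeCarrier.mk t := by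
  have key : ∀ (A : V.Alg) (v : X → A.carrier),
      (t.eval (freeOp V X) (freeUnit V X)).out.eval A.op v = (FreeCarrier.mk t).out.eval A.op v := by
    intro A v
    refine (eval_freeOp A v t (freeUnit V X)).trans ?_
    rw [FreeCarrier.out_eval]
    exact congrArg (fun w => t.eval A.op w) (funext fun x => FreeCarrier.out_eval (.var x) A v)
  exact le_antisymm (FreeCarrier.le_iff.2 fun A v => (key A v).le)
    (FreeCarrier.le_iff.2 fun A v => (key A v).ge)

/-- The free algebra is generated by the generators. -/
theorem free_induction {V : AlgVariety.{u}} {X : Type u} (B : Set (free V X).carrier)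
    (hX : ∀ x, freeUnit V X x ∈ B)
    (hB : ∀ o (a : Fin (V.arity o) → (free V X).carrier), (∀ i, a i ∈ B) → (free V X).op o a ∈ B)
    (a : (free V X).carrier) : a ∈ B := by
  have key : ∀ t : AlgTerm V.Op V.arity X, t.eval (freeOp V X) (freeUnit V X) ∈ B := by
    intro t
    induction t with
    | var x => exact hX x
    | app o t ih => exact hB o _ ih
  have h : FreeCarrier.mk (FreeCarrier.out a) ∈ B :=
    eval_var_freeOp (FreeCarrier.out a) ▸ key (FreeCarrier.out a)
  exact (FreeCarrier.mk_out a) ▸ h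

/-- Two morphisms out of a free algebra that agree on generators are equal. -/
theorem free_hom_ext {V : AlgVariety.{u}} {X : Type u} {A : V.Alg} (f g : free V X ⟶ A)
    (h : ∀ x, fn f (freeUnit V X x) = fn g (freeUnit V X x)) : f = g := by
  refine AlgHom.ext (funext fun a => ?_)
  refine free_induction {a | fn f a = fn g a} h (fun o a ha => ?_) a
  have hf : fn f ((free V X).op o a) = A.op o fun i => fn f (a i) := AlgHom.map_op f o a
  have hg : fn g ((free V X).op o a) = A.op o fun i => fn g (a i) := AlgHom.map_op g o a
  change fn f _ = fn g _
  rw [hf, hg]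
  congr 1
  exact funext ha

theorem finite_free [V.LocallyFinite] (X : Type u) [Finite X] : Finite (free V X).carrier :=
  LocallyFinite.finite_of_finGen _
    ⟨Set.range (freeUnit V X), Set.finite_range _, fun B h hB =>
      Set.eq_univ_of_forall (free_induction B (fun x => h ⟨x, rfl⟩) hB)⟩

/-- The free algebra on one generator, as a finite algebra. -/
noncomputable def freeOne [V.LocallyFinite] : V.FinAlg :=
  ⟨free V PUnit, finite_free V PUnit⟩

/-- The one-element algebra, as a finite algebra. -/
def one : V.FinAlg :=
  ⟨{ carrier := PUnit
     op := fun _ _ => PUnit.unit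
     op_mono := fun _ _ _ _ => le_rfl
     trivial_order := fun _ _ _ _ => rfl
     sat := fun _ _ _ => le_rfl }, inferInstanceAs (Finite PUnit)⟩

/-- The unique morphism to the one-element algebra. -/
def toOne {V : AlgVariety.{u}} (A : V.Alg) : A ⟶ V.one.obj :=
  AlgHom.mk (B := V.one.obj) (fun _ => PUnit.unit) (fun _ _ _ => le_rfl) (fun _ _ => rfl)

/-! ### The dualizing objects -/

section Duality

variable {D C : AlgVariety.{u}} [D.LocallyFinite] [C.LocallyFinite]
  (E : D.FinAlgᵒᵖ ≌ C.FinAlg)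

/-- The object `O_C` of `C`: the dual of the free `D`-algebra on one generator. -/
noncomputable abbrev outC : C.FinAlg := E.functor.obj (op D.freeOne)

/-- The object of outputs `O_D` of `D`: the dual of the free `C`-algebra on one generator. -/
noncomputable abbrev outD : D.FinAlg := (E.inverse.obj C.freeOne).unop

/-- The canonical bijection from the underlying set of `O_D` to that of `O_C`. It sends `y` to the
image of the generator of the free `C`-algebra on one generator under the isomorphism of the latter
with the dual of `O_D`, followed by the dual of the morphism from the free `D`-algebra on one
generator to `O_D` that is determined by `y`. -/
noncomputable def outMap (y : (outD E).obj.carrier) : (outC E).obj.carrier :=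
  fn (E.counitIso.inv.app C.freeOne ≫
      E.functor.map (Quiver.Hom.op (X := D.freeOne) (Y := outD E)
        (ObjectProperty.homMk (freeLift fun _ => y)))).hom
    (freeUnit C PUnit PUnit.unit)

/-- For a constant symbol `c` of `C`, the morphism from the one-element `D`-algebra `1` to `O_D`
that is dual to the morphism from the free `C`-algebra on one generator to the dual of `1` which
picks out the value of `c`. -/
noncomputable def botOne (c : C.Op) (hc : C.arity c = 0) : D.one ⟶ outD E :=
  Quiver.Hom.unop
    (E.inverse.map (X := C.freeOne) (Y := E.functor.obj (op D.one))
        (ObjectProperty.homMk (freeLift fun _ =>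
          (E.functor.obj (op D.one)).obj.op c fun i => Fin.elim0 (i.cast hc))) ≫
      E.unitIso.inv.app (op D.one))

/-- The morphism `⊥ : A ⟶ O_D` (dual to the constant `c`). It is natural in `A` and hence factors
through the one-element algebra. -/
noncomputable def bot (c : C.Op) (hc : C.arity c = 0) (A : D.Alg) : A ⟶ (outD E).obj :=
  toOne A ≫ (botOne E c hc).hom

end Duality

end AlgVariety

/-! ### Algebras for a monad on the `S`-sorted variety -/

section Sorted

open AlgVariety

variable {S : Type w} {D : AlgVariety.{u}}

/-- A morphism of `S`-sorted algebras is surjective if all its components are; these represent the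
quotients. -/
def SortedSurj {A B : S → D.Alg} (e : A ⟶ B) : Prop :=
  ∀ s, Function.Surjective (fn (e s))

/-- A morphism of `S`-sorted algebras is order-reflecting (injective, if `D` is a variety of
unordered algebras) if all its components are; these represent the subobjects. -/
def SortedEmb {A B : S → D.Alg} (m : A ⟶ B) : Prop :=
  ∀ s, ∀ a b, fn (m s) a ≤ fn (m s) b → a ≤ b

/-- The free `S`-sorted algebra on an `S`-sorted set. -/
noncomputable def sortedFree (D : AlgVariety.{u}) (X : S → Type u) : S → D.Alg :=
  fun s => AlgVariety.free D (X s)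

variable (T : Monad (S → D.Alg)) (F : ObjectProperty T.Algebra)

/-- `F` is a class of finite `T`-algebras closed under quotients, subalgebras and finite
products. -/
structure IsAdmissibleClass : Prop where
  finite : ∀ A, F A → ∀ s, Finite (A.A s).carrier
  quotient : ∀ (A B : T.Algebra) (e : A ⟶ B), F A → SortedSurj e.f → F B
  subalgebra : ∀ (A B : T.Algebra) (m : A ⟶ B), F B → SortedEmb m.f → F A
  finite_products : F.IsClosedUnderFiniteProducts

variable {T}

/-- The `S`-sorted quotient `e` of the `T`-algebra `A` carries a `T`-homomorphism. -/
def IsTQuotient (A : T.Algebra) {B : S → D.Alg} (e : A.A ⟶ B) : Prop :=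
  SortedSurj e ∧ ∃ b : T.obj B ⟶ B,
    T.η.app B ≫ b = 𝟙 B ∧ T.μ.app B ≫ b = T.map b ≫ b ∧ T.map e ≫ b = A.a ≫ e

/-- The `S`-sorted quotient `e` of the `T`-algebra `A` factorizes through a quotient algebra of `A`
that belongs to `F`. -/
def IsRefinable (A : T.Algebra) {B : S → D.Alg} (e : A.A ⟶ B) : Prop :=
  SortedSurj e ∧ ∃ (Q : T.Algebra) (h : A ⟶ Q), F Q ∧ SortedSurj h.f ∧
    ∃ p : Q.A ⟶ B, h.f ≫ p = e

/-- A set of unary operations `A s ⟶ A t` on an `S`-sorted algebra. -/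
abbrev UnaryOps (A : S → D.Alg) := ∀ s t : S, Set (A s ⟶ A t)

/-- The `S`-sorted quotient `e` admits a lifting of every unary operation in `U`. -/
def IsUQuotient {A B : S → D.Alg} (U : UnaryOps A) (e : A ⟶ B) : Prop :=
  SortedSurj e ∧ ∀ s t, ∀ v ∈ U s t, ∃ v' : B s ⟶ B t, v ≫ e t = e s ≫ v'

/-- `U` is a unary presentation of the `T`-algebra `A`. -/
def IsUnaryPresentation (A : T.Algebra) (U : UnaryOps A.A) : Prop :=
  ∀ (B : S → D.Alg) (e : A.A ⟶ B), IsRefinable F A e → (IsTQuotient A e ↔ IsUQuotient U e)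

/-- The closure of `U` under composition and identity morphisms. -/
inductive UnaryClosure {A : S → D.Alg} (U : UnaryOps A) : ∀ s t : S, (A s ⟶ A t) → Prop
  | of {s t : S} (v : A s ⟶ A t) : v ∈ U s t → UnaryClosure U s t v
  | id (s : S) : UnaryClosure U s s (𝟙 (A s))
  | comp {r s t : S} (v : A r ⟶ A s) (v' : A s ⟶ A t) :
      UnaryClosure U r s v → UnaryClosure U s t v' → UnaryClosure U r t (v ≫ v')

/-! ### Reduced algebras and local pseudovarieties -/

/-- A `T`-algebra is reduced (with respect to the sorts in `S₀`) if it has no proper quotient whose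
components of sorts in `S₀` are isomorphisms. -/
def IsReducedAlgebra (S₀ : Set S) (A : T.Algebra) : Prop :=
  ∀ (B : T.Algebra) (e : A ⟶ B), SortedSurj e.f → (∀ s ∈ S₀, IsIso (e.f s)) → IsIso e

/-- A representative of a `Σ`-generated reduced `F`-algebra: a quotient of the free `T`-algebra over
the alphabet `X` with reduced codomain in `F`. -/
structure GenReducedRep (S₀ : Set S) (X : S → Type u) where
  alg : T.Algebra
  hom : T.free.obj (sortedFree D X) ⟶ alg
  surj : SortedSurj hom.f
  mem : F alg
  reduced : IsReducedAlgebra S₀ alg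

/-- `e ≤ e'` if `e` factorizes through `e'`. -/
instance (S₀ : Set S) (X : S → Type u) : Preorder (GenReducedRep F S₀ X) where
  le e e' := ∃ q : e'.alg ⟶ e.alg, e'.hom ≫ q = e.hom
  le_refl e := ⟨𝟙 _, Category.comp_id _⟩
  le_trans e e' e'' := by
    rintro ⟨q, hq⟩ ⟨q', hq'⟩
    exact ⟨q' ≫ q, by rw [← Category.assoc, hq', hq]⟩

/-- The poset of generated reduced `F`-algebras over the alphabet `X`; quotients `e`, `e'` with
`e ≤ e'` and `e' ≤ e` are identified. -/
abbrev GenReducedAlg (S₀ : Set S) (X : S → Type u) :=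
  Antisymmetrization (GenReducedRep F S₀ X) (· ≤ ·)

/-- Local pseudovarieties of generated reduced `F`-algebras: ideals (nonempty, downwards closed and
directed subsets) of the poset of generated reduced `F`-algebras, ordered by inclusion. -/
abbrev LocalPseudovariety (S₀ : Set S) (X : S → Type u) :=
  Order.Ideal (GenReducedAlg F S₀ X)

/-! ### Reduced languages and local varieties -/

section Languages

variable {C : AlgVariety.{u}} [D.LocallyFinite] [C.LocallyFinite]
  (T) (E : D.FinAlgᵒᵖ ≌ C.FinAlg) (S₀ : Set S) (X : S → Type u)

/-- Reduced languages over the alphabet `X`. -/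
abbrev ReducedLanguage :=
  ∀ s : S₀, (T.obj (sortedFree D X) (s : S) ⟶ (outD E).obj)

variable {T E S₀ X}

/-- `F`-recognizable reduced languages. -/
def IsRecognizable (L : ReducedLanguage T E S₀ X) : Prop :=
  ∃ (A : T.Algebra) (h : T.free.obj (sortedFree D X) ⟶ A), SortedSurj h.f ∧ F A ∧
    ∃ p : ∀ s : S₀, (A.A (s : S) ⟶ (outD E).obj), ∀ s : S₀, L s = h.f (s : S) ≫ p s

/-- The derivative of a reduced language with respect to a unary operation between sorts in `S₀`:
it is `v ≫ L t` in sort `s` and `⊥` in all other sorts. -/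
noncomputable def derivative (c : C.Op) (hc : C.arity c = 0) (L : ReducedLanguage T E S₀ X)
    (s t : S₀) (v : T.obj (sortedFree D X) (s : S) ⟶ T.obj (sortedFree D X) (t : S)) :
    ReducedLanguage T E S₀ X :=
  letI := Classical.decEq S₀
  Function.update (fun r => bot E c hc (T.obj (sortedFree D X) (r : S))) s (v ≫ L t)

variable (T E S₀ X)

/-- Local varieties of reduced languages over the alphabet `X`. Via the bijection `outMap` between
the underlying sets of `O_D` and `O_C`, reduced languages are elements of the product over all
`s ∈ S₀` of the powers of `O_C` by the underlying set of sort `s` of the free `T`-algebra;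
the recognizable ones form a subobject of this product in `C`. -/
@[ext]
structure LocalVariety (U : UnaryOps (T.obj (sortedFree D X))) (c : C.Op)
    (hc : C.arity c = 0) where
  langs : Set (ReducedLanguage T E S₀ X)
  recognizable : ∀ L ∈ langs, IsRecognizable F L
  /-- `langs` is a subalgebra, i.e. closed under the pointwise operations of `C`. -/
  op_mem : ∀ (o : C.Op) (L : Fin (C.arity o) → ReducedLanguage T E S₀ X), (∀ k, L k ∈ langs) →
    ∃ L' ∈ langs, ∀ (s : S₀) (x : (T.obj (sortedFree D X) (s : S)).carrier),
      outMap E (fn (L' s) x) = (outC E).obj.op o fun k => outMap E (fn (L k s) x)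
  derivative_mem : ∀ L ∈ langs, ∀ (s t : S₀)
    (v : T.obj (sortedFree D X) (s : S) ⟶ T.obj (sortedFree D X) (t : S)),
    UnaryClosure U s t v → derivative c hc L s t v ∈ langs
  diagonal_mem : ∀ L : S₀ → ReducedLanguage T E S₀ X, (∀ s, L s ∈ langs) →
    (fun s => L s s) ∈ langs

/-- Local varieties are ordered by inclusion. -/
instance (U : UnaryOps (T.obj (sortedFree D X))) (c : C.Op) (hc : C.arity c = 0) :
    PartialOrder (LocalVariety T F E S₀ X U c hc) :=
  PartialOrder.lift LocalVariety.langs fun _ _ h => LocalVariety.ext h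

end Languages

end Sorted

/-- A partially ordered set in which any two elements have a supremum and an infimum. -/
def IsLatticeOrder (P : Type*) [PartialOrder P] : Prop :=
  ∀ a b : P, (∃ c, IsLUB {a, b} c) ∧ ∃ c, IsGLB {a, b} c

/-! For a finite `D`-algebra `A`, morphisms from `A` to `outD E` are the elements of the dual of `A`
(`dualElt`), and the operations of the dual are pointwise operations on languages. Hence quotients
of `A` correspond to subalgebras of its dual, i.e. to sets of languages closed under the operations
of `C`: `exists_comp_eq_of_langsOf_subset` recovers the order of quotients from the recognized
languages, and `exists_langsOf_eq` realizes every closed set.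

This is applied in each sort to a quotient `Q` of the free `T`-algebra with codomain in `F`. A
sortwise quotient of `Q` carries a homomorphism iff the unary operations lift to it, which dually
means that its languages are closed under derivatives. So families of languages recognized by `Q`
and closed under operations and derivatives come from quotient algebras
(`ClassQuotient.exists_langsOf_eq`).

Reducedness dualizes to a generation property: `Q` is reduced iff its languages of all sorts are
generated by derivatives and operations from those of sorts in `S₀` (`GenLangs`). A reduced quotient
is therefore determined by the reduced languages it recognizes.

A local pseudovariety is sent to the languages recognized by its members, a local variety to the
reduced quotients all of whose languages it contains. One composite is the identity because the
languages of a local variety recognized by a given `Q` generate a reduced quotient with languages in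
the variety (`LocalVariety.exists_genReducedRep`); the other because a reduced quotient recognizes
only finitely many reduced languages, so by directedness one member of the ideal recognizes them
all. Local varieties have a top element and intersections, hence form a lattice, and the isomorphism
transports this. -/

theorem AlgTerm.map_eval {Op : Type u} {arity : Op → ℕ} {X A B : Type u}
    {opA : (o : Op) → (Fin (arity o) → A) → A} {opB : (o : Op) → (Fin (arity o) → B) → B}
    (f : A → B) (hf : ∀ o a, f (opA o a) = opB o fun i => f (a i)) (v : X → A)
    (t : AlgTerm Op arity X) : f (t.eval opA v) = t.eval opB fun x => f (v x) := by
  induction t with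
  | var x => rfl
  | app o t ih =>
    simp only [AlgTerm.eval, hf]
    congr 1
    funext i
    exact ih i

/-! ### Factorizations, subalgebras and products in a variety -/

namespace AlgVariety

variable {V : AlgVariety.{u}}

theorem fn_mono {A B : V.Alg} (f : A ⟶ B) : Monotone (fn f) := AlgHom.mono f

theorem fn_op {A B : V.Alg} (f : A ⟶ B) (o : V.Op) (a : Fin (V.arity o) → A.carrier) :
    fn f (A.op o a) = B.op o fun i => fn f (a i) := AlgHom.map_op f o a

theorem hom_ext {A B : V.Alg} {f g : A ⟶ B} (h : ∀ a, fn f a = fn g a) : f = g :=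
  AlgHom.ext (funext h)

theorem finite_hom (A B : V.Alg) [Finite A.carrier] [Finite B.carrier] : Finite (A ⟶ B) :=
  Finite.of_injective (fun f : A ⟶ B => fn f) fun _ _ h => hom_ext fun a => congrFun h a

/-- A morphism factorizes through a surjective one that identifies (and orders) fewer elements. -/
theorem exists_comp_eq {A B Z : V.Alg} {e : A ⟶ B} (he : Function.Surjective (fn e)) (f : A ⟶ Z)
    (h : ∀ a b, fn e a ≤ fn e b → fn f a ≤ fn f b) : ∃ g : B ⟶ Z, e ≫ g = f := by
  have hs : ∀ b, fn e (Function.surjInv he b) = b := Function.surjInv_eq he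
  have key : ∀ a, fn f (Function.surjInv he (fn e a)) = fn f a := fun a =>
    le_antisymm (h _ _ (hs _).le) (h _ _ (hs _).ge)
  refine ⟨AlgHom.mk (fun b => fn f (Function.surjInv he b)) (fun b b' hb => h _ _ ?_)
    (fun o b => ?_), hom_ext key⟩
  · rwa [hs, hs]
  · rw [← fn_op, ← key, ← key (A.op o _), fn_op]
    simp only [hs]

theorem epi_of_surjective {A B : V.Alg} {e : A ⟶ B} (he : Function.Surjective (fn e)) : Epi e where
  left_cancellation g h hgh := hom_ext fun b => by
    obtain ⟨a, rfl⟩ := he b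
    exact congrArg (fun k => fn k a) hgh

/-- The subalgebra carried by a set that is closed under the operations. -/
def subAlg (A : V.Alg) (B : Set A.carrier)
    (hB : ∀ o (a : Fin (V.arity o) → A.carrier), (∀ i, a i ∈ B) → A.op o a ∈ B) : V.Alg where
  carrier := B
  op o a := ⟨A.op o fun i => a i, hB o _ fun i => (a i).2⟩
  op_mono o _ _ h := A.op_mono o fun i => h i
  trivial_order hV a b h := Subtype.ext (A.trivial_order hV _ _ h)
  sat p hp v := by
    have e := AlgTerm.map_eval (opA := fun o (a : Fin (V.arity o) → B) =>
      (⟨A.op o fun i => a i, hB o _ fun i => (a i).2⟩ : B)) (opB := A.op)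
      Subtype.val (fun _ _ => rfl) v
    exact (e p.1).le.trans ((A.sat p hp _).trans (e p.2).ge)

/-- The inclusion of a subalgebra. -/
def subAlgIncl (A : V.Alg) (B : Set A.carrier)
    (hB : ∀ o (a : Fin (V.arity o) → A.carrier), (∀ i, a i ∈ B) → A.op o a ∈ B) :
    subAlg A B hB ⟶ A :=
  AlgHom.mk (A := subAlg A B hB) (fun b => b.1) (fun _ _ h => h) (fun _ _ => rfl)

/-- Corestriction of a morphism to a subalgebra. -/
def subAlgLift {A Z : V.Alg} (B : Set A.carrier)
    (hB : ∀ o (a : Fin (V.arity o) → A.carrier), (∀ i, a i ∈ B) → A.op o a ∈ B)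
    (f : Z ⟶ A) (hf : ∀ z, fn f z ∈ B) : Z ⟶ subAlg A B hB :=
  AlgHom.mk (B := subAlg A B hB) (fun z => ⟨fn f z, hf z⟩) (fun _ _ h => fn_mono f h)
    (fun o a => Subtype.ext (fn_op f o a))

/-- The factorization of a morphism through its image. -/
theorem exists_image_factorization {A Z : V.Alg} (f : A ⟶ Z) :
    ∃ (I : V.Alg) (e : A ⟶ I) (m : I ⟶ Z), Function.Surjective (fn e) ∧
      (∀ a b, fn m a ≤ fn m b → a ≤ b) ∧ e ≫ m = f := by
  have hB : ∀ o (a : Fin (V.arity o) → Z.carrier), (∀ i, a i ∈ Set.range (fn f)) →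
      Z.op o a ∈ Set.range (fn f) := by
    intro o a ha
    choose b hb using ha
    exact ⟨A.op o b, by rw [fn_op]; simp only [hb]⟩
  refine ⟨subAlg Z _ hB, subAlgLift _ hB f fun z => ⟨z, rfl⟩, subAlgIncl Z _ hB, ?_,
    fun _ _ h => h, rfl⟩
  rintro ⟨_, a, rfl⟩
  exact ⟨a, rfl⟩

/-- The product of a family of algebras. -/
def piAlg {J : Type} (A : J → V.Alg) : V.Alg where
  carrier := ∀ j, (A j).carrier
  op o a := fun j => (A j).op o fun i => a i j
  op_mono o _ _ h := fun j => (A j).op_mono o fun i => Pi.le_def.1 (h i) j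
  trivial_order hV _ _ h := funext fun j => (A j).trivial_order hV _ _ (h j)
  sat p hp v := fun j => by
    have e := AlgTerm.map_eval
      (opA := fun o (a : Fin (V.arity o) → ∀ j, (A j).carrier) j => (A j).op o fun i => a i j)
      (opB := (A j).op) (fun b : (∀ j, (A j).carrier) => b j) (fun _ _ => rfl) v
    exact (e p.1).le.trans (((A j).sat p hp _).trans (e p.2).ge)

/-- The projections of a product. -/
def piProj {J : Type} (A : J → V.Alg) (j : J) : piAlg A ⟶ A j :=
  AlgHom.mk (A := piAlg A) (fun a => a j) (fun _ _ h => h j) (fun _ _ => rfl)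

/-- The morphism to a product with given components. -/
def piLift {J : Type} {A : J → V.Alg} {Z : V.Alg} (f : ∀ j, Z ⟶ A j) : Z ⟶ piAlg A :=
  AlgHom.mk (B := piAlg A) (fun z j => fn (f j) z) (fun _ _ h j => fn_mono (f j) h)
    (fun o a => funext fun j => fn_op (f j) o a)

/-- The subset generated by a set under the operations of an algebra. -/
inductive opClosure (A : V.Alg) (X : Set A.carrier) : A.carrier → Prop
  | of (a : A.carrier) : a ∈ X → opClosure A X a
  | op (o : V.Op) (a : Fin (V.arity o) → A.carrier) :
      (∀ i, opClosure A X (a i)) → opClosure A X (A.op o a)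

theorem finite_opClosure [V.LocallyFinite] (A : V.Alg) {X : Set A.carrier} (hX : X.Finite) :
    Finite (subAlg A {a | opClosure A X a} opClosure.op).carrier := by
  refine LocallyFinite.finite_of_finGen _
    ⟨{b | b.1 ∈ X}, hX.preimage Subtype.val_injective.injOn, fun B hXB hB => ?_⟩
  refine Set.eq_univ_of_forall fun b => ?_
  obtain ⟨a, ha⟩ := b
  induction ha with
  | of a ha => exact hXB ha
  | op o a ha ih => exact hB o (fun i => ⟨a i, ha i⟩) ih

/-- If epimorphisms of a locally finite variety are surjective, then so are epimorphisms in the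
category of finite algebras. -/
theorem surjective_of_epi_finAlg [V.LocallyFinite]
    (hepi : ∀ (A B : V.Alg) (f : A ⟶ B), Epi f → Function.Surjective (fn f))
    {A B : V.FinAlg} (f : A ⟶ B) [Epi f] : Function.Surjective (fn f.hom) := by
  refine hepi _ _ _ ⟨fun {Z} g h hgh => ?_⟩
  have := B.property
  -- The codomain `Z` may be infinite, but both morphisms land in the subalgebra generated by their
  -- images, which is finite by local finiteness; there `f` can be cancelled.
  let X : Set Z.carrier := Set.range (fn g) ∪ Set.range (fn h)
  have hX : X.Finite := (Set.finite_range _).union (Set.finite_range _)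
  let K : V.FinAlg := ⟨subAlg Z {a | opClosure Z X a} opClosure.op, finite_opClosure Z hX⟩
  let g' : B ⟶ K := ObjectProperty.homMk
    (subAlgLift _ opClosure.op g fun z => opClosure.of _ (Or.inl ⟨z, rfl⟩))
  let h' : B ⟶ K := ObjectProperty.homMk
    (subAlgLift _ opClosure.op h fun z => opClosure.of _ (Or.inr ⟨z, rfl⟩))
  have hgh' : f ≫ g' = f ≫ h' := by
    refine ObjectProperty.hom_ext _ (hom_ext fun a => Subtype.ext ?_)
    exact congrArg (fun k => fn k a) hgh
  have := (cancel_epi f).1 hgh'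
  refine hom_ext fun b => ?_
  exact congrArg (fun k : B ⟶ K => (fn k.hom b).1) this

end AlgVariety

/-! ### Languages on a finite algebra as elements of its dual -/

namespace AlgVariety

section Duality

variable {D C : AlgVariety.{u}} [C.LocallyFinite]
  (E : D.FinAlgᵒᵖ ≌ C.FinAlg)

/-- The element of the dual of a finite algebra `A` that corresponds to a morphism from `A` to the
object of outputs. -/
noncomputable def dualElt {A : D.FinAlg} (L : A ⟶ outD E) :
    (E.functor.obj (op A)).obj.carrier :=
  fn (E.counitIso.inv.app C.freeOne ≫ E.functor.map (Quiver.Hom.op (Y := outD E) L)).hom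
    (freeUnit C PUnit PUnit.unit)

/-- Morphisms `A ⟶ outD E` correspond to morphisms from the free `C`-algebra on one generator to the
dual of `A`, hence to elements of the dual. Faithfulness of `E.functor` gives injectivity here,
fullness gives surjectivity below. -/
theorem dualElt_injective (A : D.FinAlg) :
    Function.Injective (dualElt E : (A ⟶ outD E) → _) := by
  intro L L' h
  have h1 : E.counitIso.inv.app C.freeOne ≫ E.functor.map (Quiver.Hom.op (Y := outD E) L) =
      E.counitIso.inv.app C.freeOne ≫ E.functor.map (Quiver.Hom.op (Y := outD E) L') :=
    ObjectProperty.hom_ext _ (free_hom_ext _ _ fun _ => h)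
  exact Quiver.Hom.op_inj (E.functor.map_injective ((cancel_epi _).1 h1))

theorem dualElt_surjective (A : D.FinAlg) :
    Function.Surjective (dualElt E : (A ⟶ outD E) → _) := by
  intro x
  let k : C.freeOne ⟶ E.functor.obj (op A) := ObjectProperty.homMk (freeLift fun _ => x)
  obtain ⟨L, hL⟩ := E.functor.map_surjective
    (X := E.inverse.obj C.freeOne) (Y := op A) (E.counitIso.hom.app C.freeOne ≫ k)
  refine ⟨L.unop, ?_⟩
  have h : E.counitIso.inv.app C.freeOne ≫ E.functor.map L = k := by
    rw [hL, Iso.inv_hom_id_app_assoc]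
  change fn (E.counitIso.inv.app C.freeOne ≫ E.functor.map L).hom _ = x
  rw [h]
  exact freeLift_unit _ _

theorem dualElt_comp {A B : D.FinAlg} (f : A ⟶ B) (L : B ⟶ outD E) :
    dualElt E (f ≫ L) = fn (E.functor.map f.op).hom (dualElt E L) := by
  have : E.functor.map (Quiver.Hom.op (Y := outD E) (f ≫ L)) =
    E.functor.map (Quiver.Hom.op (Y := outD E) L) ≫ E.functor.map f.op := E.functor.map_comp _ _
  rw [dualElt, this, ← Category.assoc]
  rfl

/-- The languages on `A` that factorize through `e`. -/
def langsOf {A B : D.Alg} (e : A ⟶ B) : Set (A ⟶ (outD E).obj) :=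
  {L | ∃ q, e ≫ q = L}

variable {E} in
theorem langsOf_comp_subset {A B Z : D.Alg} (e : A ⟶ B) (g : B ⟶ Z) :
    langsOf E (e ≫ g) ⊆ langsOf E e := by
  rintro _ ⟨q, rfl⟩
  exact ⟨g ≫ q, (Category.assoc _ _ _).symm⟩

variable {E} in
/-- A morphism between finite algebras factorizes through a quotient if all the languages
recognized by the former are recognized by the latter. -/
theorem exists_comp_eq_of_langsOf_subset (hC : ¬ C.ordered) {A B Z : D.Alg} [hA : Finite A.carrier]
    [hB : Finite B.carrier] [hZ : Finite Z.carrier] {e : A ⟶ B} (he : Function.Surjective (fn e))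
    {f : A ⟶ Z} (h : langsOf E f ⊆ langsOf E e) : ∃ g : B ⟶ Z, e ≫ g = f := by
  let A' : D.FinAlg := ⟨A, hA⟩
  let B' : D.FinAlg := ⟨B, hB⟩
  let Z' : D.FinAlg := ⟨Z, hZ⟩
  let e' : A' ⟶ B' := ObjectProperty.homMk e
  let f' : A' ⟶ Z' := ObjectProperty.homMk f
  have := epi_of_surjective he
  -- On languages the dual of `e` is precomposition with the epimorphism `e`.
  have hinj : Function.Injective (fn (E.functor.map e'.op).hom) := by
    intro x y hxy
    obtain ⟨p, rfl⟩ := dualElt_surjective E B' x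
    obtain ⟨q, rfl⟩ := dualElt_surjective E B' y
    rw [← dualElt_comp, ← dualElt_comp] at hxy
    have h1 := congrArg (fun k => k.hom) (dualElt_injective E _ hxy)
    exact congrArg _ (ObjectProperty.hom_ext _ ((cancel_epi e).1 h1))
  have hex : ∀ x, ∃ y, fn (E.functor.map e'.op).hom y = fn (E.functor.map f'.op).hom x := by
    intro x
    obtain ⟨q, rfl⟩ := dualElt_surjective E Z' x
    obtain ⟨p, hp⟩ := h ⟨q.hom, rfl⟩
    let p' : B' ⟶ outD E := ObjectProperty.homMk p
    refine ⟨dualElt E p', ?_⟩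
    rw [← dualElt_comp, ← dualElt_comp]
    exact congrArg _ (ObjectProperty.hom_ext _ hp)
  choose k hk using hex
  -- The chosen preimages form a homomorphism because the dual of `e` is injective; monotonicity is
  -- free because `C` is unordered. The morphism dual to `K` is the required factorization.
  let K : E.functor.obj (op Z') ⟶ E.functor.obj (op B') := ObjectProperty.homMk
    (AlgHom.mk k (fun a b hab => by rw [Alg.trivial_order _ hC a b hab]) (fun o a => hinj (by
      rw [hk, fn_op, fn_op]
      simp only [hk])))
  obtain ⟨g, hg⟩ := E.functor.map_surjective K
  refine ⟨g.unop.hom, ?_⟩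
  have h1 : g ≫ e'.op = f'.op := E.functor.map_injective (by
    rw [E.functor.map_comp, hg]
    exact ObjectProperty.hom_ext _ (hom_ext hk))
  exact congrArg (fun k : op Z' ⟶ op A' => k.unop.hom) h1

variable [D.LocallyFinite]

/-- The morphism from the free algebra on one generator that picks an element. -/
noncomputable def point {A : D.FinAlg} (a : A.obj.carrier) : D.freeOne ⟶ A :=
  ObjectProperty.homMk (freeLift fun _ => a)

/-- `outMap E y` is by definition the dual element of the morphism `point y`, and `y` is the value
of that morphism at the generator. -/
theorem outMap_injective : Function.Injective (outMap E) := by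
  intro y y' h
  have h1 := congrArg (fun k : D.freeOne ⟶ outD E => fn k.hom (freeUnit D PUnit PUnit.unit))
    (dualElt_injective E _ (show dualElt E (point y) = dualElt E (point y') from h))
  exact (freeLift_unit (fun _ => y) PUnit.unit).symm.trans
    (h1.trans (freeLift_unit (fun _ => y') PUnit.unit))

theorem point_comp {A B : D.FinAlg} (f : A ⟶ B) (a : A.obj.carrier) :
    point a ≫ f = point (fn f.hom a) :=
  ObjectProperty.hom_ext _ (free_hom_ext _ _ fun x =>
    (congrArg (fn f.hom) (freeLift_unit (fun _ => a) x)).trans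
      (freeLift_unit (fun _ => fn f.hom a) x).symm)

/-- Evaluation at `a` is restriction along `point a`, so it becomes a homomorphism of `C` from the
dual of `A` to `outC E`. This is why the operations of the dual are pointwise. -/
theorem outMap_apply {A : D.FinAlg} (L : A ⟶ outD E) (a : A.obj.carrier) :
    outMap E (fn L.hom a) = fn (E.functor.map (point a).op).hom (dualElt E L) := by
  rw [← dualElt_comp, point_comp]
  rfl

/-- `L'` is obtained from `L` by applying the operation `o` of `C` pointwise. -/
def PointwiseOp {A : D.Alg} (o : C.Op) (L' : A ⟶ (outD E).obj)
    (L : Fin (C.arity o) → (A ⟶ (outD E).obj)) : Prop :=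
  ∀ x, outMap E (fn L' x) = (outC E).obj.op o fun k => outMap E (fn (L k) x)

variable {E}

theorem PointwiseOp.unique {A : D.Alg} {o : C.Op} {L' L'' : A ⟶ (outD E).obj}
    {L : Fin (C.arity o) → (A ⟶ (outD E).obj)} (h : PointwiseOp E o L' L)
    (h' : PointwiseOp E o L'' L) : L' = L'' :=
  hom_ext fun x => outMap_injective E ((h x).trans (h' x).symm)

theorem PointwiseOp.comp {A B : D.Alg} {o : C.Op} {L' : B ⟶ (outD E).obj}
    {L : Fin (C.arity o) → (B ⟶ (outD E).obj)} (h : PointwiseOp E o L' L) (f : A ⟶ B) :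
    PointwiseOp E o (f ≫ L') fun k => f ≫ L k :=
  fun x => h (fn f x)

theorem PointwiseOp.of_comp {A B : D.Alg} {o : C.Op} {L' : B ⟶ (outD E).obj}
    {L : Fin (C.arity o) → (B ⟶ (outD E).obj)} {f : A ⟶ B} (hf : Function.Surjective (fn f))
    (h : PointwiseOp E o (f ≫ L') fun k => f ≫ L k) : PointwiseOp E o L' L := by
  intro b
  obtain ⟨a, rfl⟩ := hf b
  exact h a

/-- The bijection between languages on a finite algebra and elements of its dual turns the
operations of the dual into pointwise operations. -/
theorem pointwiseOp_iff {A : D.FinAlg} {o : C.Op} {L' : A ⟶ outD E}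
    {L : Fin (C.arity o) → (A ⟶ outD E)} :
    PointwiseOp E o L'.hom (fun k => (L k).hom) ↔
      dualElt E L' = (E.functor.obj (op A)).obj.op o fun k => dualElt E (L k) := by
  have key : ∀ L' : A ⟶ outD E,
      dualElt E L' = ((E.functor.obj (op A)).obj.op o fun k => dualElt E (L k)) →
        PointwiseOp E o L'.hom (fun k => (L k).hom) := by
    intro L' h x
    rw [outMap_apply, h, fn_op]
    congr 1
    funext k
    exact (outMap_apply E _ _).symm
  refine ⟨fun h => ?_, key L'⟩
  -- The language named by the right-hand side is a pointwise result by `key`, and pointwise results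
  -- are unique.
  obtain ⟨L'', hL''⟩ := dualElt_surjective E A
    ((E.functor.obj (op A)).obj.op o fun k => dualElt E (L k))
  have : L' = L'' := ObjectProperty.hom_ext _ (h.unique (key L'' hL''))
  rw [this, hL'']

/-- The result is computed in the dual, which needs `A` finite. On the free `T`-algebra, which may
be infinite, pointwise operations are taken through finite quotients, as in the next two lemmas. -/
theorem exists_pointwiseOp (A : D.Alg) [hA : Finite A.carrier] (o : C.Op)
    (L : Fin (C.arity o) → (A ⟶ (outD E).obj)) : ∃ L', PointwiseOp E o L' L := by
  let L₁ : Fin (C.arity o) → ((⟨A, hA⟩ : D.FinAlg) ⟶ outD E) := fun k => ObjectProperty.homMk (L k)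
  obtain ⟨L', hL'⟩ := dualElt_surjective E ⟨A, hA⟩
    ((E.functor.obj (op ⟨A, hA⟩)).obj.op o fun k => dualElt E (L₁ k))
  exact ⟨L'.hom, pointwiseOp_iff.2 hL'⟩

theorem exists_mem_langsOf_pointwiseOp {A B : D.Alg} [Finite B.carrier] {e : A ⟶ B} {o : C.Op}
    {L : Fin (C.arity o) → (A ⟶ (outD E).obj)} (hL : ∀ k, L k ∈ langsOf E e) :
    ∃ L' ∈ langsOf E e, PointwiseOp E o L' L := by
  choose q hq using hL
  obtain ⟨q', hq'⟩ := exists_pointwiseOp B o q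
  obtain rfl : (fun k => e ≫ q k) = L := funext hq
  exact ⟨_, ⟨q', rfl⟩, hq'.comp e⟩

theorem langsOf_pointwiseOp {A B : D.Alg} [Finite B.carrier] {e : A ⟶ B} {o : C.Op}
    {L : Fin (C.arity o) → (A ⟶ (outD E).obj)} {L' : A ⟶ (outD E).obj} (h : PointwiseOp E o L' L)
    (hL : ∀ k, L k ∈ langsOf E e) : L' ∈ langsOf E e := by
  obtain ⟨L'', hL'', h''⟩ := exists_mem_langsOf_pointwiseOp hL
  exact h.unique h'' ▸ hL''

/-- A set of languages on a finite algebra that is closed under the pointwise operations is the set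
of languages recognized by a quotient. -/
theorem exists_langsOf_eq
    (hepi : ∀ (A B : D.Alg) (f : A ⟶ B), Epi f → Function.Surjective (fn f))
    (A : D.Alg) [hA : Finite A.carrier] (W : Set (A ⟶ (outD E).obj))
    (hW : ∀ o L L', (∀ k, L k ∈ W) → PointwiseOp E o L' L → L' ∈ W) :
    ∃ (B : D.Alg) (e : A ⟶ B), Finite B.carrier ∧ Function.Surjective (fn e) ∧
      langsOf E e = W := by
  let A' : D.FinAlg := ⟨A, hA⟩
  let P := E.functor.obj (op A')
  have := P.property
  let Q : Set P.obj.carrier := {x | ∃ L : A' ⟶ outD E, L.hom ∈ W ∧ dualElt E L = x}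
  have hQ : ∀ o (a : Fin (C.arity o) → P.obj.carrier), (∀ i, a i ∈ Q) → P.obj.op o a ∈ Q := by
    intro o a ha
    choose L hL hLa using ha
    obtain ⟨L', hL'⟩ := dualElt_surjective E A' (P.obj.op o a)
    refine ⟨L', hW o _ _ hL (pointwiseOp_iff.2 ?_), hL'⟩
    rw [hL']
    simp only [hLa]
    rfl
  let Q' : C.FinAlg := ⟨subAlg P.obj Q hQ, inferInstanceAs (Finite Q)⟩
  let i : Q' ⟶ P := ObjectProperty.homMk (subAlgIncl P.obj Q hQ)
  have hi : Mono i := ⟨fun g h hgh => ObjectProperty.hom_ext _ (hom_ext fun z =>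
    Subtype.ext (congrArg (fun k : _ ⟶ P => fn k.hom z) hgh))⟩
  -- The inclusion of the subalgebra dualizes to an epimorphism out of `A'`, which is surjective.
  let j : E.inverse.obj Q' ⟶ op A' := E.inverse.map i ≫ E.unitIso.inv.app (op A')
  have hj : Mono j := mono_comp _ _
  have hepi' : Epi j.unop := inferInstance
  refine ⟨_, j.unop.hom, (E.inverse.obj Q').unop.property, surjective_of_epi_finAlg hepi j.unop, ?_⟩
  -- By a triangle identity, dualizing once more gives back the inclusion `i` up to the counit.
  have hmap : E.functor.map j.unop.op = E.counitIso.hom.app Q' ≫ i := by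
    change E.functor.map (E.inverse.map i ≫ E.unitInv.app (op A')) = _
    rw [E.functor.map_comp, ← E.counit_app_functor]
    exact E.counitIso.hom.naturality i
  have hdual : ∀ q : (E.inverse.obj Q').unop ⟶ outD E, dualElt E (j.unop ≫ q) =
      (fn (E.counitIso.hom.app Q').hom (dualElt E q)).1 := by
    intro q
    rw [dualElt_comp, hmap]
    rfl
  ext L
  constructor
  · rintro ⟨q, rfl⟩
    let q' : (E.inverse.obj Q').unop ⟶ outD E := ObjectProperty.homMk q
    obtain ⟨L, hL, h⟩ := (fn (E.counitIso.hom.app Q').hom (dualElt E q')).2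
    rw [← hdual] at h
    have := dualElt_injective E A' h
    subst this
    exact hL
  · intro hL
    let L' : A' ⟶ outD E := ObjectProperty.homMk L
    let x : Q'.obj.carrier := (⟨dualElt E L', L', hL, rfl⟩ : Q)
    obtain ⟨q, hq⟩ := dualElt_surjective E (E.inverse.obj Q').unop
      (fn (E.counitIso.inv.app Q').hom x)
    refine ⟨q.hom, ?_⟩
    have h := hdual q
    rw [hq] at h
    have h1 := congrArg (fun k => fn k.hom x)
      (E.counitIso.inv_hom_id_app Q')
    have h2 := dualElt_injective E A' (h.trans (congrArg Subtype.val h1))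
    exact congrArg (fun k => k.hom) h2

end Duality

end AlgVariety

/-! ### Sorted algebras and `T`-algebras: images and products -/

section Sorted

open AlgVariety

variable {S : Type w} {D : AlgVariety.{u}}

theorem SortedSurj.epi {A B : S → D.Alg} {e : A ⟶ B} (he : SortedSurj e) : Epi e where
  left_cancellation g h hgh := funext fun s => by
    have := epi_of_surjective (he s)
    exact (cancel_epi (e s)).1 (congrFun hgh s)

theorem SortedSurj.comp {A B Z : S → D.Alg} {e : A ⟶ B} {g : B ⟶ Z} (he : SortedSurj e)
    (hg : SortedSurj g) : SortedSurj (e ≫ g) :=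
  fun s => (hg s).comp (he s)

theorem SortedSurj.of_comp {A B Z : S → D.Alg} {e : A ⟶ B} {g : B ⟶ Z}
    (h : SortedSurj (e ≫ g)) : SortedSurj g :=
  fun s => Function.Surjective.of_comp (h s)

/-- The components of an epimorphism of `S`-sorted algebras are epimorphisms. -/
theorem epi_apply {A B : S → D.Alg} (e : A ⟶ B) [Epi e] (s : S) : Epi (e s) where
  left_cancellation {Z} g h hgh := by
    -- A copy of `Z` in sort `s` and an empty product, hence a one-element algebra, in every other
    -- sort.
    let Z' : S → D.Alg := fun t => piAlg fun _ : PLift (s = t) => Z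
    let g' : B ⟶ Z' := fun t => piLift fun p => p.down ▸ g
    let h' : B ⟶ Z' := fun t => piLift fun p => p.down ▸ h
    have : e ≫ g' = e ≫ h' := by
      funext t
      refine hom_ext fun a => funext fun p => ?_
      obtain ⟨rfl⟩ := p
      exact congrArg (fun k => fn k a) hgh
    have h2 := congrFun ((cancel_epi e).1 this) s
    exact congrArg (fun k => k ≫ piProj (fun _ : PLift (s = s) => Z) ⟨rfl⟩) h2

theorem sortedSurj_of_epi
    (hepi : ∀ (A B : D.Alg) (f : A ⟶ B), Epi f → Function.Surjective (fn f))
    {A B : S → D.Alg} (e : A ⟶ B) [Epi e] : SortedSurj e :=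
  fun s => hepi _ _ _ (epi_apply e s)

variable {T : Monad (S → D.Alg)}

/-- Every homomorphism of `T`-algebras factorizes through its image. -/
theorem exists_algebra_image_factorization
    (hepi : ∀ (A B : D.Alg) (f : A ⟶ B), Epi f → Function.Surjective (fn f))
    (hT : T.toFunctor.PreservesEpimorphisms) {A Z : T.Algebra} (f : A ⟶ Z) :
    ∃ (I : T.Algebra) (e : A ⟶ I) (m : I ⟶ Z), SortedSurj e.f ∧ SortedEmb m.f ∧ e ≫ m = f := by
  choose I e m he hm hem using fun s => exists_image_factorization (f.f s)
  let e' : A.A ⟶ I := e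
  let m' : I ⟶ Z.A := m
  have hem' : e' ≫ m' = f.f := funext hem
  have : Epi e' := SortedSurj.epi he
  -- Since `T` preserves epimorphisms, `A.a ≫ e'` can be descended along the surjection `T.map e'`;
  -- the order-reflecting `m'` shows that this is well defined. The algebra laws then follow by
  -- cancelling epimorphisms.
  have hsurj : SortedSurj (T.map e') := sortedSurj_of_epi hepi _
  have hcond : ∀ s a b, fn (T.map e' s) a ≤ fn (T.map e' s) b →
      fn ((A.a ≫ e') s) a ≤ fn ((A.a ≫ e') s) b := by
    intro s a b hab
    refine hm s _ _ ?_
    have h1 : (A.a ≫ e') ≫ m' = T.map e' ≫ T.map m' ≫ Z.a := by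
      rw [Category.assoc, hem', ← f.h, ← hem', Functor.map_comp, Category.assoc]
    have h2 : ∀ x, fn (m s) (fn ((A.a ≫ e') s) x) =
        fn ((T.map m' ≫ Z.a) s) (fn (T.map e' s) x) :=
      fun x => congrArg (fun k : T.obj A.A ⟶ Z.A => fn (k s) x) h1
    rw [h2, h2]
    exact fn_mono _ hab
  choose b hb using fun s => exists_comp_eq (hsurj s) ((A.a ≫ e') s) (hcond s)
  let b' : T.obj I ⟶ I := b
  have hb' : T.map e' ≫ b' = A.a ≫ e' := funext hb
  have hη : T.η.app I ≫ b' = 𝟙 I := by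
    rw [← cancel_epi e', T.unit_naturality_assoc, hb', A.unit_assoc, Category.comp_id]
  have hμ : T.μ.app I ≫ b' = T.map b' ≫ b' := by
    rw [← cancel_epi (T.map (T.map e')), T.mu_naturality_assoc, hb', A.assoc_assoc,
      ← Functor.map_comp_assoc, hb', Functor.map_comp_assoc, hb']
  have hm' : T.map m' ≫ Z.a = b' ≫ m' := by
    rw [← cancel_epi (T.map e'), ← Functor.map_comp_assoc, hem', f.h, ← Category.assoc (T.map e'),
      hb', Category.assoc, hem']
  exact ⟨⟨I, b', hη, hμ⟩, ⟨e', hb'⟩, ⟨m', hm'⟩, he, hm, Monad.Algebra.Hom.ext hem'⟩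

/-- The product of a family of `S`-sorted algebras. -/
def sortedPi {J : Type} (A : J → S → D.Alg) : S → D.Alg := fun s => piAlg fun j => A j s

/-- The projections of a product of `S`-sorted algebras. -/
def sortedPiProj {J : Type} (A : J → S → D.Alg) (j : J) : sortedPi A ⟶ A j :=
  fun s => piProj (fun j => A j s) j

/-- The morphism to a product with given components. -/
def sortedPiLift {J : Type} {A : J → S → D.Alg} {Z : S → D.Alg} (f : ∀ j, Z ⟶ A j) :
    Z ⟶ sortedPi A :=
  fun s => piLift fun j => f j s

@[simp]
theorem sortedPiLift_proj {J : Type} {A : J → S → D.Alg} {Z : S → D.Alg} (f : ∀ j, Z ⟶ A j)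
    (j : J) : sortedPiLift f ≫ sortedPiProj A j = f j := rfl

theorem sortedPi_hom_ext {J : Type} {A : J → S → D.Alg} {Z : S → D.Alg}
    {f g : Z ⟶ sortedPi A}
    (h : ∀ j, f ≫ sortedPiProj A j = g ≫ sortedPiProj A j) : f = g :=
  funext fun s => hom_ext fun a => funext fun j =>
    congrArg (fun k : Z ⟶ A j => fn (k s) a) (h j)

/-- The product of a family of `T`-algebras. -/
def piAlgebra {J : Type} (A : J → T.Algebra) : T.Algebra where
  A := sortedPi fun j => (A j).A
  a := sortedPiLift fun j => T.map (sortedPiProj (fun j => (A j).A) j) ≫ (A j).a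
  unit := sortedPi_hom_ext fun j => by
    rw [Category.assoc, sortedPiLift_proj]
    refine (Monad.unit_naturality_assoc _ T (sortedPiProj (fun j => (A j).A) j) (A j).a).symm.trans ?_
    rw [(A j).unit]
    rfl
  assoc := sortedPi_hom_ext fun j => by
    rw [Category.assoc, sortedPiLift_proj, Category.assoc, sortedPiLift_proj,
      ← T.mu_naturality_assoc, (A j).assoc, ← Functor.map_comp_assoc,
      ← Functor.map_comp_assoc, sortedPiLift_proj]

/-- The projections of a product of `T`-algebras. -/
def piAlgebraProj {J : Type} (A : J → T.Algebra) (j : J) : piAlgebra A ⟶ A j where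
  f := sortedPiProj (fun j => (A j).A) j

/-- The homomorphism to a product with given components. -/
def piAlgebraLift {J : Type} {A : J → T.Algebra} {Z : T.Algebra} (f : ∀ j, Z ⟶ A j) :
    Z ⟶ piAlgebra A where
  f := sortedPiLift fun j => (f j).f
  h := sortedPi_hom_ext fun j => by
    have h1 : T.map (sortedPiLift fun j => (f j).f) ≫ T.map (sortedPiProj (fun j => (A j).A) j) =
        T.map (f j).f := by
      rw [← Functor.map_comp, sortedPiLift_proj]
    have h2 : T.map (sortedPiLift fun j => (f j).f) ≫
        T.map (sortedPiProj (fun j => (A j).A) j) ≫ (A j).a = Z.a ≫ (f j).f := by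
      rw [← Category.assoc, h1, (f j).h]
    exact h2

/-- The product of a family of `T`-algebras is a categorical product. -/
def piAlgebraIsLimit {J : Type} (A : J → T.Algebra) :
    IsLimit (Fan.mk (piAlgebra A) (piAlgebraProj A)) :=
  Fan.IsLimit.mk _ (fun s => piAlgebraLift s.proj) (fun _ _ => rfl)
    (fun s _ hm => Monad.Algebra.Hom.ext (sortedPi_hom_ext fun j =>
      congrArg (fun k : s.pt ⟶ A j => k.f) (hm j)))

/-! ### Quotients in `F` and the languages they recognize -/

variable (F : ObjectProperty T.Algebra)

/-- A quotient of the `T`-algebra `A` with codomain in `F`. -/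
structure ClassQuotient (A : T.Algebra) where
  alg : T.Algebra
  hom : A ⟶ alg
  surj : SortedSurj hom.f
  mem : F alg

variable {F} {A : T.Algebra}

/-- Finitely many quotients in `F` have an upper bound, viz. their subdirect product. -/
theorem exists_classQuotient_ge
    (hepi : ∀ (A B : D.Alg) (f : A ⟶ B), Epi f → Function.Surjective (fn f))
    (hT : T.toFunctor.PreservesEpimorphisms) (hF : IsAdmissibleClass T F) {J : Type} [Finite J]
    (Q : J → ClassQuotient F A) :
    ∃ R : ClassQuotient F A, ∀ j, ∃ g : R.alg ⟶ (Q j).alg, R.hom ≫ g = (Q j).hom := by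
  have := hF.finite_products
  obtain ⟨I, e, m, he, hm, hem⟩ :=
    exists_algebra_image_factorization hepi hT (piAlgebraLift fun j => (Q j).hom)
  refine ⟨⟨I, e, he, hF.subalgebra _ _ m (F.prop_of_isLimit_fan
    (piAlgebraIsLimit fun j => (Q j).alg) fun j => (Q j).mem) hm⟩, fun j =>
      ⟨m ≫ piAlgebraProj _ j, ?_⟩⟩
  change e ≫ m ≫ _ = _
  rw [← Category.assoc, hem]
  rfl

/-- A sorted morphism that is compatible with homomorphisms along a quotient is a homomorphism. -/
theorem exists_algebraHom (hT : T.toFunctor.PreservesEpimorphisms) {B Z : T.Algebra}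
    {e : A ⟶ B} (he : SortedSurj e.f) (f : A ⟶ Z) (g : B.A ⟶ Z.A) (h : e.f ≫ g = f.f) :
    ∃ g' : B ⟶ Z, g'.f = g ∧ e ≫ g' = f := by
  have := he.epi
  refine ⟨⟨g, ?_⟩, rfl, Monad.Algebra.Hom.ext h⟩
  rw [← cancel_epi (T.map e.f), ← Functor.map_comp_assoc, h, f.h, e.h_assoc, h]

theorem UnaryClosure.exists_lift {A B : S → D.Alg} {U : UnaryOps A} {e : A ⟶ B}
    (he : IsUQuotient U e) {s t : S} {v : A s ⟶ A t} (hv : UnaryClosure U s t v) :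
    ∃ v' : B s ⟶ B t, v ≫ e t = e s ≫ v' := by
  induction hv with
  | of v hv => exact he.2 _ _ v hv
  | id s => exact ⟨𝟙 _, by simp⟩
  | comp v v' _ _ ih ih' =>
    obtain ⟨p, hp⟩ := ih
    obtain ⟨p', hp'⟩ := ih'
    exact ⟨p ≫ p', by rw [Category.assoc, hp', ← Category.assoc, hp, Category.assoc]⟩

/-- The quotient factorizes through itself, so the unary presentation applies to it directly. -/
theorem ClassQuotient.isUQuotient {U : UnaryOps A.A} (hU : IsUnaryPresentation F A U)
    (Q : ClassQuotient F A) : IsUQuotient U Q.hom.f :=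
  (hU _ _ ⟨Q.surj, Q.alg, Q.hom, Q.mem, Q.surj, 𝟙 _, Category.comp_id _⟩).1
    ⟨Q.surj, Q.alg.a, Q.alg.unit, Q.alg.assoc, Q.hom.h⟩

variable {C : AlgVariety.{u}} [C.LocallyFinite] {E : D.FinAlgᵒᵖ ≌ C.FinAlg}

theorem ClassQuotient.langsOf_derivative {U : UnaryOps A.A} (hU : IsUnaryPresentation F A U)
    (Q : ClassQuotient F A) {s t : S} {v : A.A s ⟶ A.A t} (hv : UnaryClosure U s t v)
    {L : A.A t ⟶ (outD E).obj} (hL : L ∈ langsOf E (Q.hom.f t)) :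
    v ≫ L ∈ langsOf E (Q.hom.f s) := by
  obtain ⟨q, rfl⟩ := hL
  obtain ⟨v', hv'⟩ := hv.exists_lift (Q.isUQuotient hU)
  exact ⟨v' ≫ q, by rw [← Category.assoc, ← hv', Category.assoc]⟩

theorem ClassQuotient.langsOf_mono {Q R : ClassQuotient F A}
    (h : ∃ g : R.alg ⟶ Q.alg, R.hom ≫ g = Q.hom) (s : S) :
    langsOf E (Q.hom.f s) ⊆ langsOf E (R.hom.f s) := by
  obtain ⟨g, hg⟩ := h
  rw [← hg]
  exact langsOf_comp_subset _ _

/-- The order of quotients in `F` is determined by the languages they recognize. -/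
theorem ClassQuotient.exists_hom_of_langsOf_subset
    (hepi : ∀ (A B : D.Alg) (f : A ⟶ B), Epi f → Function.Surjective (fn f))
    (hC : ¬ C.ordered) (hT : T.toFunctor.PreservesEpimorphisms) (hF : IsAdmissibleClass T F)
    (Q R : ClassQuotient F A)
    (h : ∀ s, langsOf E (Q.hom.f s) ⊆ langsOf E (R.hom.f s)) :
    ∃ g : R.alg ⟶ Q.alg, R.hom ≫ g = Q.hom := by
  -- The duality needs a finite domain, so the free-standing `A` is replaced by a common refinement
  -- of `Q` and `R` in `F`.
  obtain ⟨J, hJ⟩ := exists_classQuotient_ge hepi hT hF (fun b : Bool => if b then Q else R)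
  obtain ⟨gQ, hQ⟩ : ∃ g : J.alg ⟶ Q.alg, J.hom ≫ g = Q.hom := hJ true
  obtain ⟨gR, hR⟩ : ∃ g : J.alg ⟶ R.alg, J.hom ≫ g = R.hom := hJ false
  have hQ' : J.hom.f ≫ gQ.f = Q.hom.f := congrArg (fun k => k.f) hQ
  have hR' : J.hom.f ≫ gR.f = R.hom.f := congrArg (fun k => k.f) hR
  have key : ∀ s, ∃ g : R.alg.A s ⟶ Q.alg.A s, gR.f s ≫ g = gQ.f s := by
    intro s
    have := hF.finite _ J.mem s
    have := hF.finite _ Q.mem s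
    have := hF.finite _ R.mem s
    have hsurj : SortedSurj gR.f := SortedSurj.of_comp (e := J.hom.f) (by rw [hR']; exact R.surj)
    refine exists_comp_eq_of_langsOf_subset (E := E) hC (hsurj s) ?_
    rintro _ ⟨q, rfl⟩
    obtain ⟨p, hp⟩ := h s ⟨q, rfl⟩
    refine ⟨p, ?_⟩
    have := epi_of_surjective (J.surj s)
    rw [← cancel_epi (J.hom.f s), ← Category.assoc, ← Category.assoc]
    exact (congrArg (fun k => k s ≫ p) hR').trans (hp.trans (congrArg (fun k => k s ≫ q) hQ').symm)
  choose g hg using key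
  have hg' : gR.f ≫ (g : R.alg.A ⟶ Q.alg.A) = gQ.f := funext hg
  obtain ⟨g', -, h'⟩ := exists_algebraHom hT R.surj Q.hom g (by
    rw [← hR', Category.assoc, hg', hQ'])
  exact ⟨g', h'⟩

/-! ### Closed families of languages, and reducedness as generation from sorts in `S₀` -/

variable [D.LocallyFinite]

/-- A family of sets of languages recognized by a quotient in `F` that is closed under the pointwise
operations and under derivatives is the family of languages recognized by a quotient in `F`. -/
theorem ClassQuotient.exists_langsOf_eq
    (hepi : ∀ (A B : D.Alg) (f : A ⟶ B), Epi f → Function.Surjective (fn f))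
    (hC : ¬ C.ordered) (hT : T.toFunctor.PreservesEpimorphisms) (hF : IsAdmissibleClass T F)
    {U : UnaryOps A.A} (hU : IsUnaryPresentation F A U)
    (Q : ClassQuotient F A) (W : ∀ s, Set (A.A s ⟶ (outD E).obj))
    (hWQ : ∀ s, W s ⊆ langsOf E (Q.hom.f s))
    (hop : ∀ s o L L', (∀ k, L k ∈ W s) → PointwiseOp E o L' L → L' ∈ W s)
    (hder : ∀ s t, ∀ v ∈ U s t, ∀ L ∈ W t, v ≫ L ∈ W s) :
    ∃ R : ClassQuotient F A, ∀ s, langsOf E (R.hom.f s) = W s := by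
  have hfin := hF.finite _ Q.mem
  choose B e hB he hlang using fun s => AlgVariety.exists_langsOf_eq (E := E) hepi (Q.alg.A s)
    {q | Q.hom.f s ≫ q ∈ W s} (fun o L L' hL hop' => hop s o _ _ hL (hop'.comp _))
  let e' : Q.alg.A ⟶ B := e
  have hlang' : ∀ s, langsOf E ((Q.hom.f ≫ e') s) = W s := by
    intro s
    ext L
    constructor
    · rintro ⟨q, rfl⟩
      have : e s ≫ q ∈ langsOf E (e s) := ⟨q, rfl⟩
      rw [hlang] at this
      simpa using this
    · intro hL
      obtain ⟨q, rfl⟩ := hWQ s hL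
      have : q ∈ langsOf E (e s) := by
        rw [hlang]
        exact hL
      obtain ⟨p, rfl⟩ := this
      exact ⟨p, Category.assoc _ _ _⟩
  have hsurj : SortedSurj (Q.hom.f ≫ e') := Q.surj.comp he
  have hUq : IsUQuotient U (Q.hom.f ≫ e') := by
    refine ⟨hsurj, fun s t v hv => ?_⟩
    obtain ⟨v', hv'⟩ := (Q.isUQuotient hU).2 s t v hv
    -- The lifting `v'` descends from `Q` to `B`: by duality this says that derivatives of languages
    -- in `W t` lie in `W s`.
    obtain ⟨g, hg⟩ := exists_comp_eq_of_langsOf_subset (E := E) hC (he s) (f := v' ≫ e t) (by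
      rintro _ ⟨q, rfl⟩
      rw [hlang]
      have : (Q.hom.f ≫ e') t ≫ q ∈ W t := hlang' t ▸ ⟨q, rfl⟩
      have := hder s t v hv _ this
      simpa [← reassoc_of% hv'] using this)
    refine ⟨g, ?_⟩
    change v ≫ Q.hom.f t ≫ e t = (Q.hom.f s ≫ e s) ≫ g
    rw [Category.assoc, hg, ← Category.assoc, hv', Category.assoc]
  obtain ⟨-, b, hη, hμ, hb⟩ :=
    (hU B (Q.hom.f ≫ e') ⟨hsurj, Q.alg, Q.hom, Q.mem, Q.surj, e', rfl⟩).2 hUq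
  let R : T.Algebra := ⟨B, b, hη, hμ⟩
  let h : A ⟶ R := ⟨Q.hom.f ≫ e', hb⟩
  obtain ⟨g, hg, -⟩ := exists_algebraHom hT Q.surj h e' rfl
  exact ⟨⟨R, h, hsurj, hF.quotient _ _ g Q.mem (hg ▸ he)⟩, hlang'⟩

variable (E) in
/-- The languages generated under the pointwise operations by the derivatives of given languages
of sorts in `S₀`. -/
inductive GenLangs {A : S → D.Alg} (U : UnaryOps A) (S₀ : Set S)
    (W : ∀ s, Set (A s ⟶ (outD E).obj)) : ∀ s, (A s ⟶ (outD E).obj) → Prop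
  | derivative {s t : S} (v : A s ⟶ A t) (L : A t ⟶ (outD E).obj) :
      t ∈ S₀ → UnaryClosure U s t v → L ∈ W t → GenLangs U S₀ W s (v ≫ L)
  | op {s : S} (o : C.Op) (L : Fin (C.arity o) → (A s ⟶ (outD E).obj))
      (L' : A s ⟶ (outD E).obj) :
      (∀ k, GenLangs U S₀ W s (L k)) → PointwiseOp E o L' L → GenLangs U S₀ W s L'

theorem GenLangs.of_mem {A : S → D.Alg} {U : UnaryOps A} {S₀ : Set S}
    {W : ∀ s, Set (A s ⟶ (outD E).obj)} {s : S} (hs : s ∈ S₀) {L : A s ⟶ (outD E).obj}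
    (hL : L ∈ W s) : GenLangs E U S₀ W s L :=
  Category.id_comp L ▸ .derivative (𝟙 _) L hs (.id s) hL

/-- Precomposition commutes with pointwise operations, so applying operations after derivatives
already yields a family closed under derivatives. -/
theorem GenLangs.comp {A : S → D.Alg} {U : UnaryOps A} {S₀ : Set S}
    {W : ∀ s, Set (A s ⟶ (outD E).obj)} {s t : S} {v : A s ⟶ A t} (hv : v ∈ U s t)
    {L : A t ⟶ (outD E).obj} (hL : GenLangs E U S₀ W t L) : GenLangs E U S₀ W s (v ≫ L) := by
  induction hL with
  | derivative v' L ht hv' hL =>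
    rw [← Category.assoc]
    exact .derivative _ L ht (.comp _ _ (.of v hv) hv') hL
  | op o L L' _ h ih => exact .op o _ _ (fun k => ih k) (h.comp v)

theorem GenLangs.mono {A : S → D.Alg} {U : UnaryOps A} {S₀ : Set S}
    {W W' : ∀ s, Set (A s ⟶ (outD E).obj)} (h : ∀ s ∈ S₀, W s ⊆ W' s) {s : S}
    {L : A s ⟶ (outD E).obj} (hL : GenLangs E U S₀ W s L) : GenLangs E U S₀ W' s L := by
  induction hL with
  | derivative v L ht hv hL => exact .derivative v L ht hv (h _ ht hL)
  | op o L L' _ h ih => exact .op o _ _ ih h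

/-- Languages recognized by a quotient in `F` are closed under both generating rules, so only the
sorts in `S₀` have to be checked. -/
theorem GenLangs.mem_langsOf (hF : IsAdmissibleClass T F)
    {U : UnaryOps A.A} (hU : IsUnaryPresentation F A U) {S₀ : Set S}
    {W : ∀ s, Set (A.A s ⟶ (outD E).obj)} (Q : ClassQuotient F A)
    (hW : ∀ s ∈ S₀, W s ⊆ langsOf E (Q.hom.f s)) {s : S} {L : A.A s ⟶ (outD E).obj}
    (hL : GenLangs E U S₀ W s L) : L ∈ langsOf E (Q.hom.f s) := by
  induction hL with
  | derivative v L ht hv hL => exact Q.langsOf_derivative hU hv (hW _ ht hL)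
  | op o L L' _ h ih =>
    have := hF.finite _ Q.mem
    exact langsOf_pointwiseOp h ih

theorem ClassQuotient.exists_langsOf_eq_genLangs
    (hepi : ∀ (A B : D.Alg) (f : A ⟶ B), Epi f → Function.Surjective (fn f))
    (hC : ¬ C.ordered) (hT : T.toFunctor.PreservesEpimorphisms) (hF : IsAdmissibleClass T F)
    {U : UnaryOps A.A} (hU : IsUnaryPresentation F A U) {S₀ : Set S}
    (Q : ClassQuotient F A) (W : ∀ s, Set (A.A s ⟶ (outD E).obj))
    (hWQ : ∀ s ∈ S₀, W s ⊆ langsOf E (Q.hom.f s)) :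
    ∃ R : ClassQuotient F A, ∀ s, langsOf E (R.hom.f s) = {L | GenLangs E U S₀ W s L} :=
  Q.exists_langsOf_eq hepi hC hT hF hU _
    (fun _ _ hL => hL.mem_langsOf hF hU Q hWQ)
    (fun _ o L L' hL h => .op o L L' hL h) (fun _ _ _ hv _ hL => hL.comp hv)

/-- A quotient in `F` is reduced if the languages it recognizes are generated by those of sorts
in `S₀`. -/
theorem ClassQuotient.isReducedAlgebra
    (hepi : ∀ (A B : D.Alg) (f : A ⟶ B), Epi f → Function.Surjective (fn f))
    (hC : ¬ C.ordered) (hT : T.toFunctor.PreservesEpimorphisms) (hF : IsAdmissibleClass T F)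
    {U : UnaryOps A.A} (hU : IsUnaryPresentation F A U) {S₀ : Set S}
    (Q : ClassQuotient F A)
    (h : ∀ s, ∀ L ∈ langsOf E (Q.hom.f s),
      GenLangs E U S₀ (fun t => langsOf E (Q.hom.f t)) s L) : IsReducedAlgebra S₀ Q.alg := by
  intro B e he hiso
  let R : ClassQuotient F A := ⟨B, Q.hom ≫ e, Q.surj.comp he, hF.quotient _ _ e Q.mem he⟩
  -- In sorts of `S₀`, `R` recognizes the same languages as `Q`, because `e` is invertible there.
  -- These generate everything `Q` recognizes, so `Q` factorizes through `R` and `g` inverts `e`.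
  obtain ⟨g, hg⟩ := ClassQuotient.exists_hom_of_langsOf_subset (E := E) hepi hC hT hF Q R
    fun s L hL => (h s L hL).mem_langsOf hF hU R (by
      rintro t ht _ ⟨q, rfl⟩
      have := hiso t ht
      exact ⟨inv (e.f t) ≫ q, by
        change (Q.hom.f t ≫ e.f t) ≫ _ = _
        simp⟩)
  have hQ := Q.surj.epi
  have heg : e ≫ g = 𝟙 _ := by
    refine Monad.Algebra.Hom.ext ((cancel_epi Q.hom.f).1 ?_)
    refine (Category.assoc Q.hom.f e.f g.f).symm.trans ?_
    exact (congrArg (fun k => k.f) hg).trans (Category.comp_id _).symm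
  have hge : g ≫ e = 𝟙 _ := by
    have := he.epi
    refine Monad.Algebra.Hom.ext ((cancel_epi e.f).1 ?_)
    have : (e ≫ g) ≫ e = e ≫ 𝟙 _ := by rw [heg, Category.id_comp, Category.comp_id]
    exact congrArg (fun k => k.f) ((Category.assoc e g e).symm.trans this)
  exact ⟨g, heg, hge⟩

/-- The languages recognized by a reduced quotient in `F` are generated by those of sorts
in `S₀`. -/
theorem ClassQuotient.genLangs_of_isReducedAlgebra
    (hepi : ∀ (A B : D.Alg) (f : A ⟶ B), Epi f → Function.Surjective (fn f))
    (hC : ¬ C.ordered) (hT : T.toFunctor.PreservesEpimorphisms) (hF : IsAdmissibleClass T F)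
    {U : UnaryOps A.A} (hU : IsUnaryPresentation F A U) {S₀ : Set S}
    (Q : ClassQuotient F A) (hQ : IsReducedAlgebra S₀ Q.alg) (s : S) {L : A.A s ⟶ (outD E).obj}
    (hL : L ∈ langsOf E (Q.hom.f s)) :
    GenLangs E U S₀ (fun t => langsOf E (Q.hom.f t)) s L := by
  -- `R` is the quotient of `Q` that recognizes just the generated languages; reducedness will force
  -- it to be all of `Q`.
  obtain ⟨R, hR⟩ := Q.exists_langsOf_eq_genLangs hepi hC hT hF hU (S₀ := S₀)
    (fun t => langsOf E (Q.hom.f t)) fun _ _ => subset_rfl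
  obtain ⟨g, hg⟩ := ClassQuotient.exists_hom_of_langsOf_subset (E := E) hepi hC hT hF R Q
    fun s L hL => by
      rw [hR] at hL
      exact hL.mem_langsOf hF hU Q fun _ _ => subset_rfl
  have hg' : Q.hom.f ≫ g.f = R.hom.f := congrArg (fun k => k.f) hg
  have hsurj : SortedSurj g.f := SortedSurj.of_comp (e := Q.hom.f) (by rw [hg']; exact R.surj)
  -- In sorts of `S₀`, `R` loses no language of `Q`, so by duality the identity factorizes through
  -- `g` there.
  have hiso : IsIso g := by
    refine hQ _ g hsurj fun t ht => ?_
    have := hF.finite _ Q.mem t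
    have := hF.finite _ R.mem t
    obtain ⟨k, hk⟩ := exists_comp_eq_of_langsOf_subset (E := E) hC (hsurj t)
      (f := 𝟙 (Q.alg.A t)) (by
        rintro _ ⟨q, rfl⟩
        have h1 : Q.hom.f t ≫ q ∈ langsOf E (R.hom.f t) := by
          rw [hR]
          exact .of_mem ht ⟨q, rfl⟩
        obtain ⟨p, hp⟩ := h1
        have := epi_of_surjective (Q.surj t)
        refine ⟨p, ?_⟩
        rw [← cancel_epi (Q.hom.f t), Category.id_comp, ← hp, ← hg']
        exact (Category.assoc _ _ _).symm)
    have := epi_of_surjective (hsurj t)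
    exact ⟨k, hk, by rw [← cancel_epi (g.f t), ← Category.assoc, hk]; simp⟩
  have h1 := ClassQuotient.langsOf_mono (E := E) (Q := Q) (R := R)
    ⟨inv g, by rw [← hg, Category.assoc, IsIso.hom_inv_id, Category.comp_id]⟩ s hL
  rw [hR] at h1
  exact h1

end Sorted

/-! ### Ideals and lattice orders -/

theorem Order.Ideal.exists_ge {P : Type*} [Preorder P] (I : Order.Ideal P) {J : Type*} [Finite J]
    (f : J → P) (hf : ∀ j, f j ∈ I) : ∃ a ∈ I, ∀ j, f j ≤ a := by
  have : Nonempty I := I.nonempty.to_subtype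
  have : IsDirectedOrder I := ⟨fun a b => by
    obtain ⟨z, hz, h1, h2⟩ := I.directed a.1 a.2 b.1 b.2
    exact ⟨⟨z, hz⟩, h1, h2⟩⟩
  obtain ⟨a, ha⟩ := Finite.exists_le fun j => (⟨f j, hf j⟩ : I)
  exact ⟨a.1, a.2, ha⟩

theorem IsLatticeOrder.of_orderIso {P Q : Type*} [PartialOrder P] [PartialOrder Q] (f : P ≃o Q)
    (h : IsLatticeOrder P) : IsLatticeOrder Q := by
  intro a b
  have hab : ({a, b} : Set Q) = f '' {f.symm a, f.symm b} := by simp [Set.image_pair]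
  obtain ⟨⟨x, hx⟩, y, hy⟩ := h (f.symm a) (f.symm b)
  rw [hab]
  exact ⟨⟨f x, f.isLUB_image'.2 hx⟩, f y, f.isGLB_image'.2 hy⟩

/-- A partially ordered set is a lattice if it has a top element and infima of nonempty subsets. -/
theorem IsLatticeOrder.of_exists_isGLB {P : Type*} [PartialOrder P] (top : P)
    (htop : ∀ a, a ≤ top) (h : ∀ s : Set P, s.Nonempty → ∃ a, IsGLB s a) : IsLatticeOrder P := by
  intro a b
  obtain ⟨x, hx⟩ := h (upperBounds {a, b}) ⟨top, fun z _ => htop z⟩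
  exact ⟨⟨x, isGLB_upperBounds.1 hx⟩, h _ ⟨a, Set.mem_insert _ _⟩⟩

/-! ### Recognition of reduced languages -/

section Sorted

open AlgVariety

variable {S : Type w} {D C : AlgVariety.{u}} [C.LocallyFinite]
  {T : Monad (S → D.Alg)} {F : ObjectProperty T.Algebra} {E : D.FinAlgᵒᵖ ≌ C.FinAlg}
  {S₀ : Set S} {X : S → Type u}

/-- `bot` factors through the one-element algebra, so padding with it never affects recognition. -/
theorem bot_mem_langsOf (c : C.Op) (hc : C.arity c = 0) {A B : D.Alg} (e : A ⟶ B) :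
    bot E c hc A ∈ langsOf E e :=
  ⟨bot E c hc B, rfl⟩

theorem derivative_self (c : C.Op) (hc : C.arity c = 0) (L : ReducedLanguage T E S₀ X)
    (s t : S₀) (v : T.obj (sortedFree D X) (s : S) ⟶ T.obj (sortedFree D X) (t : S)) :
    derivative c hc L s t v s = v ≫ L t := by
  let := Classical.decEq S₀
  exact Function.update_self ..

theorem derivative_of_ne (c : C.Op) (hc : C.arity c = 0) (L : ReducedLanguage T E S₀ X)
    {r s : S₀} (h : r ≠ s) (t : S₀)
    (v : T.obj (sortedFree D X) (s : S) ⟶ T.obj (sortedFree D X) (t : S)) :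
    derivative c hc L s t v r = bot E c hc _ := by
  let := Classical.decEq S₀
  exact Function.update_of_ne h ..

/-- The quotient `Q` recognizes the reduced language `L`. -/
def ClassQuotient.Recognizes (Q : ClassQuotient F (T.free.obj (sortedFree D X)))
    (L : ReducedLanguage T E S₀ X) : Prop :=
  ∀ s : S₀, L s ∈ langsOf E (Q.hom.f (s : S))

theorem ClassQuotient.Recognizes.isRecognizable
    {Q : ClassQuotient F (T.free.obj (sortedFree D X))} {L : ReducedLanguage T E S₀ X}
    (h : Q.Recognizes L) : IsRecognizable F L := by
  choose p hp using h
  exact ⟨Q.alg, Q.hom, Q.surj, Q.mem, p, fun s => (hp s).symm⟩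

theorem IsRecognizable.exists_recognizes {L : ReducedLanguage T E S₀ X}
    (h : IsRecognizable F L) :
    ∃ Q : ClassQuotient F (T.free.obj (sortedFree D X)), Q.Recognizes L := by
  obtain ⟨A, h, hh, hA, p, hp⟩ := h
  exact ⟨⟨A, h, hh, hA⟩, fun s => ⟨p s, (hp s).symm⟩⟩

theorem ClassQuotient.Recognizes.mono {Q R : ClassQuotient F (T.free.obj (sortedFree D X))}
    (hQR : ∃ g : R.alg ⟶ Q.alg, R.hom ≫ g = Q.hom) {L : ReducedLanguage T E S₀ X}
    (h : Q.Recognizes L) : R.Recognizes L :=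
  fun s => ClassQuotient.langsOf_mono hQR s (h s)

/-- The quotient underlying a generated reduced algebra. -/
def GenReducedRep.toQuotient (e : GenReducedRep F S₀ X) :
    ClassQuotient F (T.free.obj (sortedFree D X)) :=
  ⟨e.alg, e.hom, e.surj, e.mem⟩

/-- The class of a generated reduced algebra in the poset of generated reduced algebras. -/
abbrev GenReducedRep.toAlg (e : GenReducedRep F S₀ X) : GenReducedAlg F S₀ X :=
  toAntisymmetrization (· ≤ ·) e

theorem GenReducedRep.toAlg_surjective :
    Function.Surjective (GenReducedRep.toAlg : GenReducedRep F S₀ X → _) :=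
  Quotient.mk_surjective

/-- Every language of a sort in `S₀` that is recognized by `Q` is a component of a reduced language
recognized by `Q`. -/
theorem ClassQuotient.exists_recognizes (c : C.Op) (hc : C.arity c = 0)
    (Q : ClassQuotient F (T.free.obj (sortedFree D X))) (s : S₀)
    {L : T.obj (sortedFree D X) (s : S) ⟶ (outD E).obj}
    (hL : L ∈ langsOf E (Q.hom.f (s : S))) :
    ∃ M : ReducedLanguage T E S₀ X, Q.Recognizes M ∧ M s = L := by
  classical
  refine ⟨Function.update (fun r => bot E c hc (T.obj (sortedFree D X) (r : S))) s L, fun r => ?_,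
    Function.update_self _ _ _⟩
  by_cases h : r = s
  · subst h
    rwa [Function.update_self]
  · rw [Function.update_of_ne h]
    exact bot_mem_langsOf c hc _

/-- Recognized languages are given by families of morphisms between finite algebras, indexed by
finitely many sorts. This finiteness lets a single member of an ideal recognize all of them. -/
theorem GenReducedRep.finite_recognizes [Finite S] (hF : IsAdmissibleClass T F)
    (e : GenReducedRep F S₀ X) :
    Finite {M : ReducedLanguage T E S₀ X // e.toQuotient.Recognizes M} := by
  have := hF.finite _ e.mem
  have := (outD E).property
  have : ∀ s : S₀, Finite (e.alg.A s ⟶ (outD E).obj) := fun s => finite_hom _ _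
  let f : (∀ s : S₀, (e.alg.A s ⟶ (outD E).obj)) → ReducedLanguage T E S₀ X :=
    fun p s => e.hom.f (s : S) ≫ p s
  refine (Set.finite_range f).subset fun M hM => ?_
  choose p hp using show e.toQuotient.Recognizes M from hM
  exact ⟨p, funext hp⟩

/-! ### The correspondence between local varieties and local pseudovarieties -/

variable [D.LocallyFinite]

/-- The order of generated reduced algebras is determined by the reduced languages they
recognize. -/
theorem GenReducedRep.le_of_recognizes
    (hepi : ∀ (A B : D.Alg) (f : A ⟶ B), Epi f → Function.Surjective (fn f))
    (hC : ¬ C.ordered) (hT : T.toFunctor.PreservesEpimorphisms) (hF : IsAdmissibleClass T F)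
    (c : C.Op) (hc : C.arity c = 0) {U : UnaryOps (T.obj (sortedFree D X))}
    (hU : IsUnaryPresentation F (T.free.obj (sortedFree D X)) U) {e e' : GenReducedRep F S₀ X}
    (h : ∀ M : ReducedLanguage T E S₀ X, e.toQuotient.Recognizes M → e'.toQuotient.Recognizes M) :
    e ≤ e' := by
  refine ClassQuotient.exists_hom_of_langsOf_subset (E := E) hepi hC hT hF e.toQuotient
    e'.toQuotient fun s L hL => ?_
  refine (e.toQuotient.genLangs_of_isReducedAlgebra hepi hC hT hF hU e.reduced s hL).mem_langsOf
    hF hU _ fun t ht L hL => ?_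
  -- A language of a single sort is padded by `bot` to a reduced language; this is what the constant
  -- provides.
  obtain ⟨M, hM, rfl⟩ := e.toQuotient.exists_recognizes c hc ⟨t, ht⟩ hL
  exact h M hM ⟨t, ht⟩

/-- The languages of a local variety that are recognized by a given quotient are precisely those
recognized by a suitable reduced quotient. -/
theorem LocalVariety.exists_genReducedRep
    (hepi : ∀ (A B : D.Alg) (f : A ⟶ B), Epi f → Function.Surjective (fn f))
    (hC : ¬ C.ordered) (hT : T.toFunctor.PreservesEpimorphisms) (hF : IsAdmissibleClass T F)
    {c : C.Op} {hc : C.arity c = 0} {U : UnaryOps (T.obj (sortedFree D X))}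
    (hU : IsUnaryPresentation F (T.free.obj (sortedFree D X)) U)
    (W : LocalVariety T F E S₀ X U c hc)
    (Q : ClassQuotient F (T.free.obj (sortedFree D X))) :
    ∃ e : GenReducedRep F S₀ X,
      (∀ M : ReducedLanguage T E S₀ X, e.toQuotient.Recognizes M → M ∈ W.langs) ∧
      ∀ M ∈ W.langs, Q.Recognizes M → e.toQuotient.Recognizes M := by
  let V : ∀ s, Set (T.obj (sortedFree D X) s ⟶ (outD E).obj) := fun s =>
    {L | L ∈ langsOf E (Q.hom.f s) ∧ ∃ hs : s ∈ S₀, ∃ M ∈ W.langs, M ⟨s, hs⟩ = L}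
  obtain ⟨R, hR⟩ := Q.exists_langsOf_eq_genLangs hepi hC hT hF hU (S₀ := S₀) V
    fun s _ _ h => h.1
  -- Back in sorts of `S₀`, generation does not leave the components of `W`: derivatives stay by
  -- `derivative_mem`, and uniqueness of pointwise results identifies `L'` with a component of the
  -- language from `op_mem`.
  have hgen : ∀ s L, GenLangs E U S₀ V s L →
      ∀ hs : s ∈ S₀, ∃ M ∈ W.langs, M ⟨s, hs⟩ = L := by
    intro s L hL hs
    induction hL with
    | derivative v L ht hv hL =>
      obtain ⟨-, ht, M, hM, rfl⟩ := hL
      exact ⟨_, W.derivative_mem M hM ⟨_, hs⟩ ⟨_, ht⟩ v hv, derivative_self ..⟩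
    | op o L L' _ h ih =>
      choose M hM hML using fun k => ih k
      obtain ⟨M', hM', h'⟩ := W.op_mem o M hM
      refine ⟨M', hM', PointwiseOp.unique (L := L) (o := o) ?_ h⟩
      obtain rfl := funext hML
      exact h' ⟨_, hs⟩
  refine ⟨⟨R.alg, R.hom, R.surj, R.mem, R.isReducedAlgebra (E := E) hepi hC hT hF hU
    fun s L hL => ?_⟩, fun M hM => ?_, fun M hM hQ s => ?_⟩
  · rw [hR] at hL
    refine hL.mono fun t ht L hL => ?_
    rw [hR]
    exact .of_mem ht hL
  -- Each component of `M` comes from its own member of `W`; closure under diagonals assembles them.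
  · have : ∀ s : S₀, ∃ N ∈ W.langs, N s = M s := fun s => hgen s _ (by
      have h : M s ∈ langsOf E (R.hom.f s) := hM s
      rwa [hR] at h) s.2
    choose N hN hNM using this
    have h := W.diagonal_mem N hN
    rwa [funext hNM] at h
  · change M s ∈ langsOf E (R.hom.f s)
    rw [hR]
    exact .of_mem s.2 ⟨hQ s, s.2, M, hM, rfl⟩

/-- The local variety of all reduced languages recognized by members of a directed class of
quotients. -/
def LocalVariety.ofQuotients [Finite S] (hF : IsAdmissibleClass T F)
    {U : UnaryOps (T.obj (sortedFree D X))}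
    (hU : IsUnaryPresentation F (T.free.obj (sortedFree D X)) U) (c : C.Op) (hc : C.arity c = 0)
    (K : Set (ClassQuotient F (T.free.obj (sortedFree D X))))
    (hK : ∀ (n : ℕ) (f : Fin n → ClassQuotient F (T.free.obj (sortedFree D X))),
      (∀ j, f j ∈ K) → ∃ R ∈ K, ∀ j, ∃ g : R.alg ⟶ (f j).alg, R.hom ≫ g = (f j).hom) :
    LocalVariety T F E S₀ X U c hc where
  langs := {L | ∃ Q ∈ K, Q.Recognizes L}
  recognizable := fun _ ⟨_, _, h⟩ => h.isRecognizable
  op_mem o L hL := by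
    choose f hf hfL using hL
    -- For a constant of `C` this is the case of the empty family, which provides some member of
    -- `K`.
    obtain ⟨R, hR, hRf⟩ := hK _ f hf
    have hfin := hF.finite _ R.mem
    choose L' hL' hop using fun s : S₀ =>
      exists_mem_langsOf_pointwiseOp (o := o) fun k => ((hfL k).mono (hRf k)) s
    exact ⟨L', ⟨R, hR, hL'⟩, hop⟩
  derivative_mem := by
    rintro L ⟨Q, hQ, hL⟩ s t v hv
    refine ⟨Q, hQ, fun r => ?_⟩
    by_cases h : r = s
    · subst h
      rw [derivative_self]
      exact Q.langsOf_derivative hU hv (hL t)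
    · rw [derivative_of_ne _ _ _ h]
      exact bot_mem_langsOf c hc _
  diagonal_mem L hL := by
    choose f hf hfL using hL
    obtain ⟨n, ⟨i⟩⟩ := Finite.exists_equiv_fin S₀
    obtain ⟨R, hR, hRf⟩ := hK n (fun j => f (i.symm j)) fun j => hf _
    refine ⟨R, hR, fun s => ?_⟩
    have h := hRf (i s)
    rw [i.symm_apply_apply] at h
    exact ((hfL s).mono h) s

/-- Intersections of local varieties are local varieties. -/
theorem LocalVariety.exists_isGLB {U : UnaryOps (T.obj (sortedFree D X))} {c : C.Op}
    {hc : C.arity c = 0} (P : Set (LocalVariety T F E S₀ X U c hc)) (hP : P.Nonempty) :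
    ∃ W, IsGLB P W := by
  obtain ⟨W₀, hW₀⟩ := hP
  let W : LocalVariety T F E S₀ X U c hc :=
    { langs := {L | ∀ W ∈ P, L ∈ W.langs}
      recognizable := fun L hL => W₀.recognizable L (hL W₀ hW₀)
      op_mem := fun o L hL => by
        -- Pointwise results are unique, so the one found in `W₀` lies in every member of `P`.
        obtain ⟨L', -, h⟩ := W₀.op_mem o L fun k => hL k W₀ hW₀
        refine ⟨L', fun W hW => ?_, h⟩
        obtain ⟨L'', hL'', h''⟩ := W.op_mem o L fun k => hL k W hW
        have : L' = L'' := funext fun s => PointwiseOp.unique (h s) (h'' s)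
        exact this ▸ hL''
      derivative_mem := fun L hL s t v hv W hW => W.derivative_mem L (hL W hW) s t v hv
      diagonal_mem := fun L hL W hW => W.diagonal_mem L fun s => hL s W hW }
  exact ⟨W, fun V hV L hL => hL V hV, fun V hV L hL Z hZ => hV hZ hL⟩

/-- Local varieties form a lattice. -/
theorem LocalVariety.isLatticeOrder [Finite S]
    (hepi : ∀ (A B : D.Alg) (f : A ⟶ B), Epi f → Function.Surjective (fn f))
    (hT : T.toFunctor.PreservesEpimorphisms) (hF : IsAdmissibleClass T F)
    {c : C.Op} {hc : C.arity c = 0} {U : UnaryOps (T.obj (sortedFree D X))}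
    (hU : IsUnaryPresentation F (T.free.obj (sortedFree D X)) U) :
    IsLatticeOrder (LocalVariety T F E S₀ X U c hc) := by
  -- `Set.univ` yields the top element, the variety of all recognizable reduced languages.
  refine .of_exists_isGLB (.ofQuotients hF hU c hc Set.univ fun n f _ => ?_) (fun W L hL => ?_)
    LocalVariety.exists_isGLB
  · obtain ⟨R, hR⟩ := exists_classQuotient_ge hepi hT hF f
    exact ⟨R, trivial, hR⟩
  · obtain ⟨Q, hQ⟩ := (W.recognizable L hL).exists_recognizes
    exact ⟨Q, trivial, hQ⟩

/-- The local variety of reduced languages recognized by members of a local pseudovariety. -/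
def LocalPseudovariety.toLocalVariety [Finite S] (hF : IsAdmissibleClass T F)
    {U : UnaryOps (T.obj (sortedFree D X))}
    (hU : IsUnaryPresentation F (T.free.obj (sortedFree D X)) U) (c : C.Op) (hc : C.arity c = 0)
    (I : LocalPseudovariety F S₀ X) : LocalVariety T F E S₀ X U c hc :=
  .ofQuotients hF hU c hc {Q | ∃ e : GenReducedRep F S₀ X, e.toAlg ∈ I ∧ e.toQuotient = Q}
    fun n f hf => by
      choose e he hef using hf
      obtain ⟨a, ha, hea⟩ := Order.Ideal.exists_ge I _ he
      obtain ⟨e', rfl⟩ := GenReducedRep.toAlg_surjective a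
      refine ⟨_, ⟨e', ha, rfl⟩, fun j => ?_⟩
      rw [← hef]
      exact toAntisymmetrization_le_toAntisymmetrization_iff.1 (hea j)

theorem LocalPseudovariety.mem_toLocalVariety [Finite S] {hF : IsAdmissibleClass T F}
    {U : UnaryOps (T.obj (sortedFree D X))}
    {hU : IsUnaryPresentation F (T.free.obj (sortedFree D X)) U} {c : C.Op} {hc : C.arity c = 0}
    {I : LocalPseudovariety F S₀ X} {L : ReducedLanguage T E S₀ X} :
    L ∈ (LocalPseudovariety.toLocalVariety (E := E) hF hU c hc I).langs ↔
      ∃ e : GenReducedRep F S₀ X, e.toAlg ∈ I ∧ e.toQuotient.Recognizes L := by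
  constructor
  · rintro ⟨_, ⟨e, he, rfl⟩, h⟩
    exact ⟨e, he, h⟩
  · rintro ⟨e, he, h⟩
    exact ⟨_, ⟨e, he, rfl⟩, h⟩

/-- The local pseudovariety of generated reduced algebras that recognize only languages of a given
local variety. -/
def LocalVariety.toLocalPseudovariety
    (hepi : ∀ (A B : D.Alg) (f : A ⟶ B), Epi f → Function.Surjective (fn f))
    (hC : ¬ C.ordered) (hT : T.toFunctor.PreservesEpimorphisms) (hF : IsAdmissibleClass T F)
    {c : C.Op} {hc : C.arity c = 0} {U : UnaryOps (T.obj (sortedFree D X))}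
    (hU : IsUnaryPresentation F (T.free.obj (sortedFree D X)) U)
    (W : LocalVariety T F E S₀ X U c hc) : LocalPseudovariety F S₀ X where
  -- Quantifying over all `e` below `a` makes the condition independent of representatives and
  -- downward closed.
  carrier := {a | ∀ e : GenReducedRep F S₀ X, e.toAlg ≤ a →
    ∀ M : ReducedLanguage T E S₀ X, e.toQuotient.Recognizes M → M ∈ W.langs}
  lower' := fun _ _ hba ha e he => ha e (he.trans hba)
  nonempty' := by
    obtain ⟨Q, -⟩ := exists_classQuotient_ge (A := T.free.obj (sortedFree D X)) hepi hT hF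
      (fun j : Fin 0 => j.elim0)
    obtain ⟨e, he, -⟩ := W.exists_genReducedRep hepi hC hT hF hU Q
    exact ⟨e.toAlg, fun e' he' M hM =>
      he M (hM.mono (toAntisymmetrization_le_toAntisymmetrization_iff.1 he'))⟩
  directed' := by
    intro a ha b hb
    obtain ⟨e₁, rfl⟩ := GenReducedRep.toAlg_surjective a
    obtain ⟨e₂, rfl⟩ := GenReducedRep.toAlg_surjective b
    obtain ⟨Q, hQ⟩ := exists_classQuotient_ge hepi hT hF
      (fun i : Bool => if i then e₁.toQuotient else e₂.toQuotient)
    obtain ⟨e, he, heQ⟩ := W.exists_genReducedRep hepi hC hT hF hU Q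
    refine ⟨e.toAlg, fun e' he' M hM =>
      he M (hM.mono (toAntisymmetrization_le_toAntisymmetrization_iff.1 he')), ?_, ?_⟩
    -- Languages of `e₁` lie in `W` and are recognized by `Q`, hence by `e`.
    · exact toAntisymmetrization_le_toAntisymmetrization_iff.2
        (GenReducedRep.le_of_recognizes (E := E) hepi hC hT hF c hc hU fun M hM =>
          heQ M (ha e₁ le_rfl M hM) (hM.mono (hQ true)))
    · exact toAntisymmetrization_le_toAntisymmetrization_iff.2
        (GenReducedRep.le_of_recognizes (E := E) hepi hC hT hF c hc hU fun M hM =>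
          heQ M (hb e₂ le_rfl M hM) (hM.mono (hQ false)))

theorem LocalVariety.toAlg_mem_toLocalPseudovariety
    {hepi : ∀ (A B : D.Alg) (f : A ⟶ B), Epi f → Function.Surjective (fn f)}
    {hC : ¬ C.ordered} {hT : T.toFunctor.PreservesEpimorphisms} {hF : IsAdmissibleClass T F}
    {c : C.Op} {hc : C.arity c = 0} {U : UnaryOps (T.obj (sortedFree D X))}
    {hU : IsUnaryPresentation F (T.free.obj (sortedFree D X)) U}
    {W : LocalVariety T F E S₀ X U c hc} {e : GenReducedRep F S₀ X} :
    e.toAlg ∈ W.toLocalPseudovariety hepi hC hT hF hU ↔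
      ∀ M : ReducedLanguage T E S₀ X, e.toQuotient.Recognizes M → M ∈ W.langs :=
  ⟨fun h => h e le_rfl, fun h _ he' M hM =>
    h M (hM.mono (toAntisymmetrization_le_toAntisymmetrization_iff.1 he'))⟩

/-- The isomorphism between local varieties and local pseudovarieties. -/
def localVarietyOrderIso [Finite S]
    (hepi : ∀ (A B : D.Alg) (f : A ⟶ B), Epi f → Function.Surjective (fn f))
    (hC : ¬ C.ordered) (hT : T.toFunctor.PreservesEpimorphisms) (hF : IsAdmissibleClass T F)
    {c : C.Op} {hc : C.arity c = 0} {U : UnaryOps (T.obj (sortedFree D X))}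
    (hU : IsUnaryPresentation F (T.free.obj (sortedFree D X)) U) :
    LocalVariety T F E S₀ X U c hc ≃o LocalPseudovariety F S₀ X :=
  Equiv.toOrderIso
    { toFun := fun W => W.toLocalPseudovariety hepi hC hT hF hU
      invFun := fun I => LocalPseudovariety.toLocalVariety hF hU c hc I
      left_inv := fun W => by
        refine LocalVariety.ext (Set.ext fun L => ?_)
        rw [LocalPseudovariety.mem_toLocalVariety]
        simp only [LocalVariety.toAlg_mem_toLocalPseudovariety]
        refine ⟨fun ⟨e, he, h⟩ => he L h, fun hL => ?_⟩
        obtain ⟨Q, hQ⟩ := (W.recognizable L hL).exists_recognizes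
        obtain ⟨e, he, heQ⟩ := W.exists_genReducedRep hepi hC hT hF hU Q
        exact ⟨e, he, heQ L hL hQ⟩
      right_inv := fun I => by
        refine Order.Ideal.ext (Set.ext fun a => ?_)
        obtain ⟨e, rfl⟩ := GenReducedRep.toAlg_surjective a
        rw [SetLike.mem_coe, SetLike.mem_coe, LocalVariety.toAlg_mem_toLocalPseudovariety]
        simp only [LocalPseudovariety.mem_toLocalVariety]
        refine ⟨fun h => ?_, fun he M hM => ⟨e, he, hM⟩⟩
        -- Each of the finitely many languages of `e` is recognized by a member of `I`; an upper
        -- bound in `I` recognizes all of them and so lies above `e`.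
        have := e.finite_recognizes (E := E) hF
        choose f hf hfM using
          fun M : {M : ReducedLanguage T E S₀ X // e.toQuotient.Recognizes M} => h M.1 M.2
        obtain ⟨a, ha, hfa⟩ := Order.Ideal.exists_ge I _ hf
        obtain ⟨e', rfl⟩ := GenReducedRep.toAlg_surjective a
        refine I.lower (toAntisymmetrization_le_toAntisymmetrization_iff.2 ?_) ha
        exact GenReducedRep.le_of_recognizes (E := E) hepi hC hT hF c hc hU fun M hM =>
          (hfM ⟨M, hM⟩).mono (toAntisymmetrization_le_toAntisymmetrization_iff.1 (hfa ⟨M, hM⟩)) }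
    (fun _ _ h _ ha e he M hM => h (ha e he M hM))
    (fun I I' h L hL => by
      obtain ⟨e, he, hL⟩ := (LocalPseudovariety.mem_toLocalVariety (hF := hF) (hU := hU)).1 hL
      exact (LocalPseudovariety.mem_toLocalVariety (hF := hF) (hU := hU)).2 ⟨e, h he, hL⟩)

end Sorted

theorem mainTheorem6 {S : Type w} [Finite S]
    (D C : AlgVariety.{u}) [D.LocallyFinite] [C.LocallyFinite] (hC : ¬ C.ordered)
    (hepi : ∀ (A B : D.Alg) (f : A ⟶ B), Epi f → Function.Surjective (AlgVariety.fn f))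
    (T : Monad (S → D.Alg)) (hT : T.toFunctor.PreservesEpimorphisms)
    (F : ObjectProperty T.Algebra) (hF : IsAdmissibleClass T F)
    (E : D.FinAlgᵒᵖ ≌ C.FinAlg) (c : C.Op) (hc : C.arity c = 0)
    (S₀ : Set S) (X : S → Type u) (hX : ∀ s, Finite (X s))
    (U : UnaryOps (T.obj (sortedFree D X)))
    (hU : IsUnaryPresentation F (T.free.obj (sortedFree D X)) U) :
    IsLatticeOrder (LocalVariety T F E S₀ X U c hc) ∧
    IsLatticeOrder (LocalPseudovariety F S₀ X) ∧
    Nonempty (LocalVariety T F E S₀ X U c hc ≃o LocalPseudovariety F S₀ X) := by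
  have h := LocalVariety.isLatticeOrder (E := E) (S₀ := S₀) (c := c) (hc := hc) hepi hT hF hU
  let f := localVarietyOrderIso (E := E) (S₀ := S₀) (c := c) (hc := hc) hepi hC hT hF hU
  exact ⟨h, h.of_orderIso f, ⟨f⟩⟩
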